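/- Write $\mathbb R^+=[0,\infty)$. An algebra weight is a positive Borel function $w$ on $\mathbb R^+$ such that $w$ and $1/w$ are locally bounded, $w$ is right continuous, $w(t+s)\le w(t)w(s)$ for all $t,s\in\mathbb R^+$, and $w(0)=1$. Let $\omega=(\omega_n)$ be a (pointwise) increasing sequence of algebra weights such that for every $n$: (i) $\omega_n(t)\to\infty$ as $t\to\infty$; (ii) $\omega_n(t)^{1/t}\to1$ as $t\to\infty$; (iii) $\sup_{t\in\mathbb R^+}\omega_{n+1}(t)/\omega_n(t)=\infty$. Let $A(\omega)=\bigcap_nL^1(\omega_n)$ be the space of (classes of) measurable functions $f:\mathbb R^+\to\mathbb C$ with $\|f\|_n=\int_0^\infty|f(t)|\,\omega_n(t)\,dt<\infty$ for all $n$, and let $B(\omega)=\bigcap_nM(\omega_n)$ be the space of complex Borel measures $\nu$ on $\mathbb R^+$ with $\|\nu\|_n=\int_{\mathbb R^+}\omega_n\,d|\nu|<\infty$ for all $n$; both are equipped with the Fréchet space topology given by the norms $\|\cdot\|_n$, and $A(\omega)\subseteq B(\omega)$ by identifying $f$ with the measure $f(t)\,dt$. A linear operator between Fréchet spaces is called Montel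 (respectively weakly Montel) if it maps bounded sets to relatively compact (respectively weakly relatively compact) sets. Suppose that for every $n$ there exists $m$ such that $t\,\omega_n(t)/\omega_m(t)\to0$ as $t\to\infty$, and let $\mu\in B(\omega)$. Let $\overline D_\mu\nu=(X\nu)*\mu$ for $\nu\in B(\omega)$, where $d(X\nu)(t)=t\,d\nu(t)$ and $*$ is convolution of measures on $\mathbb R^+$, and let $D_\mu f=(Xf)*\mu$ for $f\in A(\omega)$, where $(Xf)(t)=tf(t)$; these are well-defined linear operators on $B(\omega)$ and $A(\omega)$ respectively. Then the following conditions are equivalent: (a) $D_\mu$ is Montel on $A(\omega)$; (b) $D_\mu$ is weakly Montel on $A(\omega)$; (c) $\mu$ is absolutely continuous with respect to Lebesgue measure; (d) $\overline D_\mu$ is Montel on $B(\omega)$; (e) $\overline D_\mu$ is weakly Montel on $B(\omega)$. -/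

import Mathlib

open MeasureTheory Filter Topology
open scoped NNReal ENNReal

noncomputable section

namespace WeightedConv

/-! ### Weights on the half line `ℝ⁺ = [0, ∞)` -/

/-- An algebra weight on `[0, ∞)`. -/
structure IsAlgebraWeight (w : ℝ≥0 → ℝ) : Prop where
  pos : ∀ t, 0 < w t
  measurable : Measurable w
  locallyBounded : ∀ T, ∃ C, ∀ t ≤ T, w t ≤ C
  inv_locallyBounded : ∀ T, ∃ C, ∀ t ≤ T, (w t)⁻¹ ≤ C
  rightContinuous : ∀ t, ContinuousWithinAt w (Set.Ici t) t
  submul : ∀ t s, w (t + s) ≤ w t * w s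
  map_zero : w 0 = 1

/-- An increasing sequence `ω = (ω_n)` of algebra weights satisfying the three standing growth
conditions that define the algebras `A(ω)` and `B(ω)`. -/
structure IsWeightSequence (ω : ℕ → ℝ≥0 → ℝ) : Prop where
  weight : ∀ n, IsAlgebraWeight (ω n)
  mono : Monotone ω
  tendsto_atTop : ∀ n, Tendsto (ω n) atTop atTop
  tendsto_root : ∀ n, Tendsto (fun t : ℝ≥0 => ω n t ^ (1 / (t : ℝ))) atTop (𝓝 1)
  unbounded_ratio : ∀ n, ¬ BddAbove (Set.range fun t => ω (n + 1) t / ω n t)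

/-- For every `n` there is `m` with `sup_t t ω_n(t) / ω_m(t) < ∞`. -/
def DerivationCondition (ω : ℕ → ℝ≥0 → ℝ) : Prop :=
  ∀ n, ∃ m, BddAbove (Set.range fun t : ℝ≥0 => (t : ℝ) * ω n t / ω m t)

/-- For every `n` there is `m` with `t ω_n(t) / ω_m(t) → 0` as `t → ∞`. -/
def StrongDerivationCondition (ω : ℕ → ℝ≥0 → ℝ) : Prop :=
  ∀ n, ∃ m, Tendsto (fun t : ℝ≥0 => (t : ℝ) * ω n t / ω m t) atTop (𝓝 0)

theorem StrongDerivationCondition.derivationCondition {ω : ℕ → ℝ≥0 → ℝ}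
    (h : StrongDerivationCondition ω) (hω : IsWeightSequence ω) : DerivationCondition ω := by
  intro n
  obtain ⟨m, hm⟩ := h n
  refine ⟨m, ?_⟩
  obtain ⟨T, hT⟩ := eventually_atTop.1 (hm.eventually (gt_mem_nhds (zero_lt_one (α := ℝ))))
  obtain ⟨C, hC⟩ := (hω.weight n).locallyBounded T
  obtain ⟨K, hK⟩ := (hω.weight m).inv_locallyBounded T
  refine ⟨max 1 (T * C * K), ?_⟩
  rintro _ ⟨t, rfl⟩
  rcases le_total T t with h1 | h1
  · exact le_max_of_le_left (hT t h1).le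
  · refine le_max_of_le_right ?_
    have h2 : (t : ℝ) ≤ T := by exact_mod_cast h1
    have h3 := ((hω.weight n).pos t).le
    have h4 := (inv_pos.2 ((hω.weight m).pos t)).le
    have h5 : 0 ≤ C := h3.trans (hC t h1)
    simp only [div_eq_mul_inv]
    gcongr
    · exact hC t h1
    · exact hK t h1

theorem IsWeightSequence.exists_lower_bound {ω : ℕ → ℝ≥0 → ℝ} (hω : IsWeightSequence ω) (n : ℕ) :
    ∃ c : ℝ, 0 < c ∧ ∀ t, c ≤ ω n t := by
  obtain ⟨T, hT⟩ := eventually_atTop.1 ((hω.tendsto_atTop n).eventually_ge_atTop 1)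
  obtain ⟨K, hK⟩ := (hω.weight n).inv_locallyBounded T
  have hK0 : 0 < K := (inv_pos.2 ((hω.weight n).pos 0)).trans_le (hK 0 (zero_le))
  refine ⟨min 1 K⁻¹, by positivity, fun t => ?_⟩
  rcases le_total T t with h1 | h1
  · exact min_le_of_left_le (hT t h1)
  · exact min_le_of_right_le (inv_le_of_inv_le₀ ((hω.weight n).pos t) (hK t h1))

/-! ### Measures on `[0, ∞)` -/

/-- Lebesgue measure on `[0, ∞)`. -/
def lebesgue : Measure ℝ≥0 := (volume : Measure ℝ).comap ((↑) : ℝ≥0 → ℝ)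

theorem measurableEmbedding_coe : MeasurableEmbedding ((↑) : ℝ≥0 → ℝ) :=
  MeasurableEmbedding.subtype_coe measurableSet_Ici

instance : SigmaFinite lebesgue := by
  refine SigmaFinite.of_map _ measurable_subtype_coe.aemeasurable
    (f := ((↑) : ℝ≥0 → ℝ)) ?_
  rw [lebesgue]
  erw [measurableEmbedding_coe.map_comap]
  infer_instance

/-- The complex measure `X ν`, given by `(X ν)(E) = ∫_E t dν(t)`. -/
def mulX (ν : ComplexMeasure ℝ≥0) : ComplexMeasure ℝ≥0 :=
  ν.withDensity (fun t => (t : ℝ)) (ContinuousLinearMap.lsmul ℝ ℝ)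

/-- The convolution `ν * μ` of complex measures on `[0, ∞)`: the image of the product measure
under addition. -/
def cconv (ν μ : ComplexMeasure ℝ≥0) : ComplexMeasure ℝ≥0 :=
  (ν.prod μ (ContinuousLinearMap.mul ℝ ℂ)).map fun p => p.1 + p.2

/-- Absolute continuity of a complex measure with respect to Lebesgue measure. -/
def IsAbsCont (μ : ComplexMeasure ℝ≥0) : Prop :=
  VectorMeasure.AbsolutelyContinuous μ lebesgue.toENNRealVectorMeasure

theorem isAbsCont_iff {μ : ComplexMeasure ℝ≥0} :
    IsAbsCont μ ↔ ∀ s, MeasurableSet s → lebesgue s = 0 → μ s = 0 := by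
  constructor
  · intro h s hs h0
    exact h (by rw [Measure.toENNRealVectorMeasure_apply_measurable hs, h0])
  · intro h s h0
    by_cases hs : MeasurableSet s
    · exact h s hs (by rwa [Measure.toENNRealVectorMeasure_apply_measurable hs] at h0)
    · exact μ.not_measurable hs

/-! ### The Fréchet spaces `B(ω)` and `A(ω)` -/

/-- The norm `∫ ω_n d|ν|`, as an extended real number. -/
def enormB (ω : ℕ → ℝ≥0 → ℝ) (n : ℕ) (ν : ComplexMeasure ℝ≥0) : ℝ≥0∞ :=
  ∫⁻ t, ENNReal.ofReal (ω n t) ∂ν.variation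

theorem enormB_zero (ω : ℕ → ℝ≥0 → ℝ) (n : ℕ) : enormB ω n 0 = 0 := by simp [enormB]

theorem enormB_add_le (ω : ℕ → ℝ≥0 → ℝ) (n : ℕ) (ν μ : ComplexMeasure ℝ≥0) :
    enormB ω n (ν + μ) ≤ enormB ω n ν + enormB ω n μ := by
  rw [enormB, enormB, enormB, ← lintegral_add_measure]
  exact lintegral_mono' VectorMeasure.variation_add_le le_rfl

theorem enormB_smul (ω : ℕ → ℝ≥0 → ℝ) (n : ℕ) (c : ℂ) (ν : ComplexMeasure ℝ≥0) :
    enormB ω n (c • ν) = ‖c‖ₑ * enormB ω n ν := by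
  rw [enormB, enormB, VectorMeasure.variation_smul, lintegral_smul_measure]
  rfl

/-- `B(ω) = ⋂_n M(ω_n)` as a space of complex measures: all `ν` with `∫ ω_n d|ν| < ∞` for all `n`.
(As `ω_n` is bounded away from `0`, a locally finite measure in `M(ω_n)` has finite total
variation, so that it is a complex measure in the usual sense.) -/
def subB (ω : ℕ → ℝ≥0 → ℝ) : Submodule ℂ (ComplexMeasure ℝ≥0) where
  carrier := {ν | ∀ n, enormB ω n ν < ∞}
  zero_mem' n := by simp [enormB_zero]
  add_mem' h1 h2 n := (enormB_add_le ω n _ _).trans_lt (ENNReal.add_lt_top.2 ⟨h1 n, h2 n⟩)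
  smul_mem' c ν h n := by
    rw [enormB_smul]
    exact ENNReal.mul_lt_top enorm_lt_top (h n)

/-- The Fréchet space `B(ω)`. -/
def B (ω : ℕ → ℝ≥0 → ℝ) : Type := subB ω

instance (ω : ℕ → ℝ≥0 → ℝ) : AddCommGroup (B ω) := inferInstanceAs (AddCommGroup (subB ω))
instance (ω : ℕ → ℝ≥0 → ℝ) : Module ℂ (B ω) := inferInstanceAs (Module ℂ (subB ω))

/-- The measure underlying an element of `B(ω)`. -/
def B.toMeasure {ω : ℕ → ℝ≥0 → ℝ} : B ω →ₗ[ℂ] ComplexMeasure ℝ≥0 := (subB ω).subtype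

/-- The norms `‖ν‖_n = ∫ ω_n d|ν|` of `B(ω)`. -/
def seminormB (ω : ℕ → ℝ≥0 → ℝ) : SeminormFamily ℂ (B ω) ℕ := fun n =>
  Seminorm.of (fun ν => (enormB ω n ν.toMeasure).toReal)
    (fun ν μ => by
      have h1 : enormB ω n ν.toMeasure < ∞ := ν.2 n
      have h2 : enormB ω n μ.toMeasure < ∞ := μ.2 n
      change (enormB ω n (ν.toMeasure + μ.toMeasure)).toReal ≤ _
      rw [← ENNReal.toReal_add h1.ne h2.ne]
      exact ENNReal.toReal_mono (ENNReal.add_lt_top.2 ⟨h1, h2⟩).ne (enormB_add_le ω n _ _))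
    (fun c ν => by
      change (enormB ω n (c • ν.toMeasure)).toReal = _
      rw [enormB_smul, ENNReal.toReal_mul, toReal_enorm])

/-- The topology of `B(ω)` is the one given by the norms `‖·‖_n`. -/
instance (ω : ℕ → ℝ≥0 → ℝ) : TopologicalSpace (B ω) := (seminormB ω).moduleFilterBasis.topology

theorem withSeminorms_B (ω : ℕ → ℝ≥0 → ℝ) : WithSeminorms (seminormB ω) := ⟨rfl⟩

instance (ω : ℕ → ℝ≥0 → ℝ) : IsTopologicalAddGroup (B ω) := (withSeminorms_B ω).topologicalAddGroup
instance (ω : ℕ → ℝ≥0 → ℝ) : ContinuousSMul ℂ (B ω) := (withSeminorms_B ω).continuousSMul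

/-- `A(ω) = ⋂_n L¹(ω_n)`: all (classes of) functions `f` on `[0, ∞)` with `f ω_n ∈ L¹` for
all `n`. -/
def subA (ω : ℕ → ℝ≥0 → ℝ) : Submodule ℂ (ℝ≥0 →ₘ[lebesgue] ℂ) where
  carrier := {f | ∀ n, Integrable (fun t => f t * (ω n t : ℂ)) lebesgue}
  zero_mem' n := by
    refine (integrable_zero ℝ≥0 ℂ lebesgue).congr ?_
    filter_upwards [AEEqFun.coeFn_zero (α := ℝ≥0) (β := ℂ) (μ := lebesgue)] with t ht
    simp [ht]
  add_mem' {f g} hf hg n := by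
    refine ((hf n).add (hg n)).congr ?_
    filter_upwards [AEEqFun.coeFn_add f g] with t ht
    simp [ht, add_mul]
  smul_mem' c f hf n := by
    refine ((hf n).smul c).congr ?_
    filter_upwards [AEEqFun.coeFn_smul c f] with t ht
    simp [ht, mul_assoc]

/-- The Fréchet space `A(ω)`. -/
def A (ω : ℕ → ℝ≥0 → ℝ) : Type := subA ω

instance (ω : ℕ → ℝ≥0 → ℝ) : AddCommGroup (A ω) := inferInstanceAs (AddCommGroup (subA ω))
instance (ω : ℕ → ℝ≥0 → ℝ) : Module ℂ (A ω) := inferInstanceAs (Module ℂ (subA ω))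

/-- The function class underlying an element of `A(ω)`. -/
def A.toFun {ω : ℕ → ℝ≥0 → ℝ} : A ω →ₗ[ℂ] (ℝ≥0 →ₘ[lebesgue] ℂ) := (subA ω).subtype

theorem A.integrable_mul {ω : ℕ → ℝ≥0 → ℝ} (f : A ω) (n : ℕ) :
    Integrable (fun t => f.toFun t * (ω n t : ℂ)) lebesgue := f.2 n

/-- The norms `‖f‖_n = ∫ |f(t)| ω_n(t) dt` of `A(ω)`. -/
def seminormA (ω : ℕ → ℝ≥0 → ℝ) : SeminormFamily ℂ (A ω) ℕ := fun n =>
  Seminorm.of (fun f => ∫ t, ‖f.toFun t * (ω n t : ℂ)‖ ∂lebesgue)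
    (fun f g => by
      rw [← integral_add (f.integrable_mul n).norm (g.integrable_mul n).norm]
      refine integral_mono_ae ((f + g).integrable_mul n).norm
        ((f.integrable_mul n).norm.add (g.integrable_mul n).norm) ?_
      filter_upwards [AEEqFun.coeFn_add f.toFun g.toFun] with t ht
      rw [map_add, ht, Pi.add_apply, add_mul]
      exact norm_add_le _ _)
    (fun c f => by
      rw [← integral_const_mul]
      refine integral_congr_ae ?_
      filter_upwards [AEEqFun.coeFn_smul c f.toFun] with t ht
      rw [map_smul, ht, Pi.smul_apply, smul_eq_mul, mul_assoc, norm_mul c])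

/-- The topology of `A(ω)` is the one given by the norms `‖·‖_n`. -/
instance (ω : ℕ → ℝ≥0 → ℝ) : TopologicalSpace (A ω) := (seminormA ω).moduleFilterBasis.topology

theorem withSeminorms_A (ω : ℕ → ℝ≥0 → ℝ) : WithSeminorms (seminormA ω) := ⟨rfl⟩

instance (ω : ℕ → ℝ≥0 → ℝ) : IsTopologicalAddGroup (A ω) := (withSeminorms_A ω).topologicalAddGroup
instance (ω : ℕ → ℝ≥0 → ℝ) : ContinuousSMul ℂ (A ω) := (withSeminorms_A ω).continuousSMul

/-! ### The inclusion of `A(ω)` in `B(ω)` -/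

section

variable {ω : ℕ → ℝ≥0 → ℝ}

theorem IsWeightSequence.measurable_ofReal (hω : IsWeightSequence ω) (n : ℕ) :
    Measurable fun t => ENNReal.ofReal (ω n t) :=
  (hω.weight n).measurable.ennreal_ofReal

theorem IsWeightSequence.isFiniteMeasure (hω : IsWeightSequence ω) {ν : ComplexMeasure ℝ≥0}
    {n : ℕ} (h : enormB ω n ν < ∞) : IsFiniteMeasure ν.variation := by
  obtain ⟨c, hc, hc'⟩ := hω.exists_lower_bound n
  refine ⟨?_⟩
  by_contra h1
  rw [not_lt, top_le_iff] at h1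
  have h2 : ∫⁻ _, ENNReal.ofReal c ∂ν.variation ≤ enormB ω n ν :=
    lintegral_mono fun t => ENNReal.ofReal_le_ofReal (hc' t)
  rw [lintegral_const, h1, ENNReal.mul_top (by simpa using hc)] at h2
  exact (h2.trans_lt h).ne rfl

theorem IsWeightSequence.integrable_of_mul (hω : IsWeightSequence ω) {f : ℝ≥0 → ℂ} {n : ℕ}
    (hf : AEStronglyMeasurable f lebesgue)
    (h : Integrable (fun t => f t * (ω n t : ℂ)) lebesgue) : Integrable f lebesgue := by
  obtain ⟨c, hc, hc'⟩ := hω.exists_lower_bound n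
  refine (h.norm.const_mul c⁻¹).mono' hf (Eventually.of_forall fun t => ?_)
  have h1 : |ω n t| = ω n t := abs_of_pos (((hω.weight n).pos t))
  rw [norm_mul, Complex.norm_real, Real.norm_eq_abs, h1, inv_mul_eq_div, le_div_iff₀ hc]
  exact mul_le_mul_of_nonneg_left (hc' t) (norm_nonneg _)

theorem A.integrable (hω : IsWeightSequence ω) (f : A ω) : Integrable f.toFun lebesgue :=
  hω.integrable_of_mul f.toFun.aestronglyMeasurable (f.integrable_mul 0)

theorem enormB_withDensity (hω : IsWeightSequence ω) {f : ℝ≥0 → ℂ} (hf : Integrable f lebesgue)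
    (n : ℕ) :
    enormB ω n (lebesgue.withDensityᵥ f) = ∫⁻ t, ‖f t * (ω n t : ℂ)‖ₑ ∂lebesgue := by
  rw [enormB, Measure.variation_withDensityᵥ hf,
    lintegral_withDensity_eq_lintegral_mul₀ hf.aestronglyMeasurable.enorm
      (hω.measurable_ofReal n).aemeasurable]
  refine lintegral_congr fun t => ?_
  rw [Pi.mul_apply, enorm_mul, ← ofReal_norm (ω n t : ℂ), Complex.norm_real, Real.norm_eq_abs,
    abs_of_pos ((hω.weight n).pos t)]

/-- The inclusion `A(ω) ⊆ B(ω)`, which identifies `f` with the measure `f(t) dt`. -/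
def incl (hω : IsWeightSequence ω) : A ω →ₗ[ℂ] B ω where
  toFun f := ⟨lebesgue.withDensityᵥ f.toFun, fun n => by
    rw [enormB_withDensity hω (f.integrable hω)]
    exact (f.integrable_mul n).2⟩
  map_add' f g := Subtype.ext <| by
    change lebesgue.withDensityᵥ (f + g).toFun = _ + _
    rw [← withDensityᵥ_add (f.integrable hω) (g.integrable hω), map_add]
    exact WithDensityᵥEq.congr_ae (AEEqFun.coeFn_add _ _)
  map_smul' c f := Subtype.ext <| by
    change lebesgue.withDensityᵥ (c • f).toFun = c • lebesgue.withDensityᵥ f.toFun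
    rw [← withDensityᵥ_smul, map_smul]
    exact WithDensityᵥEq.congr_ae (AEEqFun.coeFn_smul _ _)

theorem incl_toMeasure (hω : IsWeightSequence ω) (f : A ω) :
    (incl hω f).toMeasure = lebesgue.withDensityᵥ f.toFun := rfl

theorem incl_injective (hω : IsWeightSequence ω) : Function.Injective (incl hω) := by
  intro f g h
  have h1 : lebesgue.withDensityᵥ f.toFun = lebesgue.withDensityᵥ g.toFun :=
    congrArg B.toMeasure h
  exact Subtype.ext (AEEqFun.ext
    (Integrable.ae_eq_of_withDensityᵥ_eq (f.integrable hω) (g.integrable hω) h1))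

theorem isAbsCont_incl (hω : IsWeightSequence ω) (f : A ω) : IsAbsCont (incl hω f).toMeasure := by
  rw [isAbsCont_iff]
  intro s hs h0
  rw [incl_toMeasure, withDensityᵥ_apply (f.integrable hω) hs, Measure.restrict_zero_set h0,
    integral_zero_measure]

theorem withDensity_rnDeriv_of_isAbsCont {ν : ComplexMeasure ℝ≥0} (h : IsAbsCont ν) :
    lebesgue.withDensityᵥ (ν.rnDeriv lebesgue) = ν := by
  obtain ⟨h1, h2⟩ := (ComplexMeasure.absolutelyContinuous_ennreal_iff _ _).1 h
  have h3 := SignedMeasure.withDensityᵥ_rnDeriv_eq _ _ h1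
  have h4 := SignedMeasure.withDensityᵥ_rnDeriv_eq _ _ h2
  have hi := ν.integrable_rnDeriv lebesgue
  ext s hs
  rw [withDensityᵥ_apply hi hs]
  apply Complex.ext
  · rw [← RCLike.re_eq_complex_re, ← integral_re hi.integrableOn, RCLike.re_eq_complex_re]
    change ∫ t in s, (ν.re.rnDeriv lebesgue t) ∂lebesgue = ν.re s
    rw [← withDensityᵥ_apply (SignedMeasure.integrable_rnDeriv _ _) hs, h3]
  · rw [← RCLike.im_eq_complex_im, ← integral_im hi.integrableOn, RCLike.im_eq_complex_im]
    change ∫ t in s, (ν.im.rnDeriv lebesgue t) ∂lebesgue = ν.im s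
    rw [← withDensityᵥ_apply (SignedMeasure.integrable_rnDeriv _ _) hs, h4]

/-- The image of `A(ω)` in `B(ω)` consists of the absolutely continuous measures. -/
theorem mem_range_incl (hω : IsWeightSequence ω) {ν : B ω} (h : IsAbsCont ν.toMeasure) :
    ν ∈ LinearMap.range (incl hω) := by
  have hi := ν.toMeasure.integrable_rnDeriv lebesgue
  have h1 := withDensity_rnDeriv_of_isAbsCont h
  have hae := AEEqFun.coeFn_mk _ hi.aestronglyMeasurable
  refine ⟨⟨AEEqFun.mk _ hi.aestronglyMeasurable, fun n => ?_⟩, Subtype.ext ?_⟩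
  · refine Integrable.congr (f := fun t => ν.toMeasure.rnDeriv lebesgue t * (ω n t : ℂ)) ⟨?_, ?_⟩ ?_
    · exact hi.aestronglyMeasurable.mul
        (Complex.measurable_ofReal.comp (hω.weight n).measurable).aestronglyMeasurable
    · rw [hasFiniteIntegral_iff_enorm, ← enormB_withDensity hω hi, h1]
      exact ν.2 n
    · filter_upwards [hae] with t ht
      rw [ht]
  · exact (WithDensityᵥEq.congr_ae hae).trans h1

/-! ### The derivations `D_μ` -/

theorem DerivationCondition.moment_lt_top (hω : IsWeightSequence ω) (hc : DerivationCondition ω)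
    (ν : B ω) (n : ℕ) :
    ∫⁻ t, ‖(t : ℝ)‖ₑ * ENNReal.ofReal (ω n t) ∂ν.toMeasure.variation < ∞ := by
  obtain ⟨m, C, hC⟩ := hc n
  have h1 : ∀ t : ℝ≥0, ‖(t : ℝ)‖ₑ * ENNReal.ofReal (ω n t)
      ≤ ENNReal.ofReal C * ENNReal.ofReal (ω m t) := fun t => by
    have h2 : (t : ℝ) * ω n t / ω m t ≤ C := hC ⟨t, rfl⟩
    have hp := (hω.weight m).pos t
    rw [div_le_iff₀ hp] at h2
    rw [Real.enorm_of_nonneg t.coe_nonneg, ← ENNReal.ofReal_mul t.coe_nonneg, ← ENNReal.ofReal_mul' hp.le]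
    exact ENNReal.ofReal_le_ofReal h2
  refine (lintegral_mono h1).trans_lt ?_
  rw [lintegral_const_mul _ (hω.measurable_ofReal m)]
  exact ENNReal.mul_lt_top ENNReal.ofReal_lt_top (ν.2 m)

theorem integrable_coe (hω : IsWeightSequence ω) (hc : DerivationCondition ω)
    (ν : B ω) : ν.toMeasure.Integrable fun t : ℝ≥0 => (t : ℝ) := by
  obtain ⟨c, hc0, hc'⟩ := hω.exists_lower_bound 0
  refine ⟨measurable_coe_nnreal_real.aestronglyMeasurable, ?_⟩
  rw [hasFiniteIntegral_iff_enorm]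
  have h1 : ENNReal.ofReal c * ∫⁻ t : ℝ≥0, ‖(t : ℝ)‖ₑ ∂ν.toMeasure.variation < ∞ := by
    rw [← lintegral_const_mul _ (measurable_coe_nnreal_real.enorm)]
    refine (lintegral_mono fun t => ?_).trans_lt (hc.moment_lt_top hω ν 0)
    rw [mul_comm]
    gcongr
    exact hc' t
  exact ENNReal.lt_top_of_mul_ne_top_right h1.ne (by simpa using hc0)

theorem enormB_mulX_lt_top (hω : IsWeightSequence ω) (hc : DerivationCondition ω)
    (ν : B ω) (n : ℕ) : enormB ω n (mulX ν.toMeasure) < ∞ := by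
  refine lt_of_le_of_lt ?_ (hc.moment_lt_top hω ν n)
  refine (lintegral_mono' VectorMeasure.variation_WithDensity_le le_rfl).trans ?_
  rw [VectorMeasure.variation_transpose_lsmul, lintegral_withDensity_eq_lintegral_mul _
    measurable_coe_nnreal_real.enorm (hω.measurable_ofReal n)]
  exact le_rfl

theorem mulX_add {ν μ : ComplexMeasure ℝ≥0} (hν : ν.Integrable fun t : ℝ≥0 => (t : ℝ))
    (hμ : μ.Integrable fun t : ℝ≥0 => (t : ℝ)) : mulX (ν + μ) = mulX ν + mulX μ := by
  ext s hs
  rw [_root_.add_apply, mulX, mulX, mulX, VectorMeasure.withDensity_apply hν,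
    VectorMeasure.withDensity_apply hμ, VectorMeasure.withDensity_apply (hν.add_vectorMeasure hμ),
    VectorMeasure.restrict_add, VectorMeasure.integral_add_vectorMeasure hν.restrict hμ.restrict]

theorem integral_csmul {ν : ComplexMeasure ℝ≥0} {f : ℝ≥0 → ℝ} (hf : ν.Integrable f) (c : ℂ) :
    (c • ν).integral f (ContinuousLinearMap.lsmul ℝ ℝ) =
      c • ν.integral f (ContinuousLinearMap.lsmul ℝ ℝ) := by
  have h1 := VectorMeasure.continuousLinearMap_apply_integral
    (B := ContinuousLinearMap.lsmul ℝ ℝ) (C := ContinuousLinearMap.mul ℝ ℂ c) hf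
  rw [ContinuousLinearMap.mul_apply'] at h1
  rw [smul_eq_mul, h1]
  set B' := (ContinuousLinearMap.compL ℝ ℂ ℂ ℂ (ContinuousLinearMap.mul ℝ ℂ c)).comp
    (ContinuousLinearMap.lsmul ℝ ℝ : ℝ →L[ℝ] ℂ →L[ℝ] ℂ) with hB'
  have hT : (c • ν).transpose (ContinuousLinearMap.lsmul ℝ ℝ : ℝ →L[ℝ] ℂ →L[ℝ] ℂ) =
      ν.transpose B' := by
    refine VectorMeasure.ext fun s hs => ContinuousLinearMap.ext fun x => ?_
    change x • (c * ν s) = c * (x • ν s)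
    exact (mul_smul_comm _ _ _).symm
  have key : ∀ (m : Measure ℝ≥0) (T : Set ℝ≥0 → ℝ →L[ℝ] ℂ) (C : ℝ)
      (hD : DominatedFinMeasAdditive m T C), m = ‖c‖₊ • ν.variation → T = ν.transpose B' →
      setToFun m T hD f = ν.integral f B' := by
    rintro m T C hD rfl rfl
    exact (setToFun_congr_smul_measure' _ (dominatedFinMeasAdditive_cbmApplyMeasure ν B') hD f).symm
  exact key _ _ _ _ VectorMeasure.variation_smul (congrArg _ hT)

theorem mulX_smul {ν : ComplexMeasure ℝ≥0} (hν : ν.Integrable fun t : ℝ≥0 => (t : ℝ)) (c : ℂ) :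
    mulX (c • ν) = c • mulX ν := by
  have hI : (c • ν).Integrable fun t : ℝ≥0 => (t : ℝ) := by
    refine (hν.smul_measure_nnreal (c := ‖c‖₊)).mono_measure ?_
    rw [VectorMeasure.variation_smul]
  ext s hs
  rw [_root_.smul_apply, mulX, mulX, VectorMeasure.withDensity_apply hν,
    VectorMeasure.withDensity_apply hI, VectorMeasure.restrict_smul, integral_csmul hν.restrict]

theorem enormB_cconv_le (hω : IsWeightSequence ω) (n : ℕ) (ν μ : ComplexMeasure ℝ≥0)
    [IsFiniteMeasure ν.variation] [IsFiniteMeasure μ.variation] :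
    enormB ω n (cconv ν μ) ≤ enormB ω n ν * enormB ω n μ := by
  have hm := hω.measurable_ofReal n
  have hle : (cconv ν μ).variation ≤
      (ν.variation.prod μ.variation).map fun p => p.1 + p.2 := by
    refine VectorMeasure.variation_map_le.trans (Measure.map_mono ?_ measurable_add)
    refine VectorMeasure.variation_prod_le.trans ?_
    have h1 : ‖ContinuousLinearMap.mul ℝ ℂ‖ₑ ≤ 1 := by
      rw [← ofReal_norm, ENNReal.ofReal_le_one]
      exact ContinuousLinearMap.opNorm_mul_le ℝ ℂ
    calc _ ≤ (1 : ℝ≥0∞) • ν.variation.prod μ.variation := by gcongr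
      _ = _ := one_smul _ _
  refine (lintegral_mono' hle le_rfl).trans ?_
  rw [lintegral_map hm measurable_add, enormB, enormB, ← lintegral_prod_mul hm.aemeasurable
    hm.aemeasurable]
  refine lintegral_mono fun p => ?_
  rw [← ENNReal.ofReal_mul ((hω.weight n).pos _).le]
  exact ENNReal.ofReal_le_ofReal ((hω.weight n).submul _ _)

theorem cconv_add_left (ν ν' μ : ComplexMeasure ℝ≥0) [IsFiniteMeasure μ.variation] :
    cconv (ν + ν') μ = cconv ν μ + cconv ν' μ := by
  rw [cconv, cconv, cconv, ← VectorMeasure.map_add]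
  congr 1
  refine VectorMeasure.prod_eq_of_forall_apply_prod fun s t hs ht => ?_
  simp [VectorMeasure.prod_apply]

theorem cconv_smul_left (c : ℂ) (ν μ : ComplexMeasure ℝ≥0) [IsFiniteMeasure μ.variation] :
    cconv (c • ν) μ = c • cconv ν μ := by
  rw [cconv, cconv, ← VectorMeasure.map_smul]
  congr 1
  refine VectorMeasure.prod_eq_of_forall_apply_prod fun s t hs ht => ?_
  simp [VectorMeasure.prod_apply, mul_assoc]

theorem isAbsCont_mulX {ν : ComplexMeasure ℝ≥0} (hν : ν.Integrable fun t : ℝ≥0 => (t : ℝ))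
    (h : IsAbsCont ν) : IsAbsCont (mulX ν) := by
  rw [isAbsCont_iff] at h ⊢
  intro s hs h0
  have h1 : ν.restrict s = 0 := by
    ext t ht
    rw [VectorMeasure.restrict_apply _ hs ht, _root_.zero_apply]
    exact h _ (ht.inter hs) (measure_mono_null Set.inter_subset_right h0)
  rw [mulX, VectorMeasure.withDensity_apply hν, h1, VectorMeasure.integral_zero_vectorMeasure]

theorem lebesgue_preimage_add {s : Set ℝ≥0} (h0 : lebesgue s = 0) (a : ℝ≥0) :
    lebesgue ((fun t => t + a) ⁻¹' s) = 0 := by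
  rw [lebesgue, measurableEmbedding_coe.comap_apply] at h0 ⊢
  refine measure_mono_null ?_ ((measure_preimage_add_right volume (a : ℝ) _).trans h0)
  rintro _ ⟨t, ht, rfl⟩
  exact ⟨t + a, ht, by simp⟩

theorem isAbsCont_cconv {ν μ : ComplexMeasure ℝ≥0} [IsFiniteMeasure ν.variation]
    [IsFiniteMeasure μ.variation] (h : IsAbsCont ν) : IsAbsCont (cconv ν μ) := by
  rw [isAbsCont_iff] at h ⊢
  intro s hs h0
  have hswap : ν.prod μ (ContinuousLinearMap.mul ℝ ℂ) =
      (μ.prod ν (ContinuousLinearMap.mul ℝ ℂ).flip).map Prod.swap := by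
    refine VectorMeasure.prod_eq_of_forall_apply_prod fun u v hu hv => ?_
    rw [VectorMeasure.map_apply _ measurable_swap (hu.prod hv), Set.preimage_swap_prod]
    simp [VectorMeasure.prod_apply, mul_comm]
  have hs' : MeasurableSet ((fun p : ℝ≥0 × ℝ≥0 => p.1 + p.2) ⁻¹' s) := measurable_add hs
  rw [cconv, hswap, VectorMeasure.map_apply _ measurable_add hs,
    VectorMeasure.map_apply _ measurable_swap hs',
    VectorMeasure.prod_flip_apply_eq_integral (measurable_swap hs')]
  have h1 : ∀ a : ℝ≥0, ν (Prod.mk a ⁻¹' (Prod.swap ⁻¹' ((fun p : ℝ≥0 × ℝ≥0 => p.1 + p.2) ⁻¹' s)))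
      = 0 := fun a =>
    h _ (measurable_prodMk_left (measurable_swap hs')) (lebesgue_preimage_add h0 a)
  simp only [h1]
  exact VectorMeasure.integral_zero

/-- The derivation `D̄_μ ν = (X ν) * μ` on `B(ω)`. -/
def derivB (hω : IsWeightSequence ω) (hc : DerivationCondition ω) (μ : B ω) : B ω →ₗ[ℂ] B ω where
  toFun ν := ⟨cconv (mulX ν.toMeasure) μ.toMeasure, fun n => by
    have : IsFiniteMeasure μ.toMeasure.variation := hω.isFiniteMeasure (μ.2 0)
    have := hω.isFiniteMeasure (enormB_mulX_lt_top hω hc ν 0)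
    exact (enormB_cconv_le hω n _ _).trans_lt
      (ENNReal.mul_lt_top (enormB_mulX_lt_top hω hc ν n) (μ.2 n))⟩
  map_add' ν ν' := Subtype.ext <| by
    have : IsFiniteMeasure μ.toMeasure.variation := hω.isFiniteMeasure (μ.2 0)
    change cconv (mulX (ν.toMeasure + ν'.toMeasure)) μ.toMeasure = cconv _ _ + cconv _ _
    rw [mulX_add (integrable_coe hω hc ν) (integrable_coe hω hc ν'), cconv_add_left]
  map_smul' c ν := Subtype.ext <| by
    have : IsFiniteMeasure μ.toMeasure.variation := hω.isFiniteMeasure (μ.2 0)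
    change cconv (mulX (c • ν.toMeasure)) μ.toMeasure = c • cconv _ _
    rw [mulX_smul (integrable_coe hω hc ν), cconv_smul_left]

theorem derivB_toMeasure (hω : IsWeightSequence ω) (hc : DerivationCondition ω) (μ ν : B ω) :
    (derivB hω hc μ ν).toMeasure = cconv (mulX ν.toMeasure) μ.toMeasure := rfl

theorem derivB_incl_mem (hω : IsWeightSequence ω) (hc : DerivationCondition ω) (μ : B ω)
    (f : A ω) : derivB hω hc μ (incl hω f) ∈ LinearMap.range (incl hω) := by
  have : IsFiniteMeasure μ.toMeasure.variation := hω.isFiniteMeasure (μ.2 0)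
  have := hω.isFiniteMeasure (enormB_mulX_lt_top hω hc (incl hω f) 0)
  exact mem_range_incl hω (isAbsCont_cconv
    (isAbsCont_mulX (integrable_coe hω hc _) (isAbsCont_incl hω f)))

/-- The derivation `D_μ f = (X f) * μ` on `A(ω)`: the function `D_μ f` is the density of the
absolutely continuous measure `(X f dt) * μ`. -/
def derivA (hω : IsWeightSequence ω) (hc : DerivationCondition ω) (μ : B ω) : A ω →ₗ[ℂ] A ω :=
  (LinearEquiv.ofInjective (incl hω) (incl_injective hω)).symm.toLinearMap ∘ₗ
    (derivB hω hc μ ∘ₗ incl hω).codRestrict (LinearMap.range (incl hω)) (derivB_incl_mem hω hc μ)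

theorem incl_derivA (hω : IsWeightSequence ω) (hc : DerivationCondition ω) (μ : B ω) (f : A ω) :
    incl hω (derivA hω hc μ f) = derivB hω hc μ (incl hω f) :=
  congrArg Subtype.val ((LinearEquiv.ofInjective (incl hω) (incl_injective hω)).apply_symm_apply
    ⟨derivB hω hc μ (incl hω f), derivB_incl_mem hω hc μ f⟩)

end

/-! ### Montel operators -/

section

variable {E F : Type*} [AddCommGroup E] [Module ℂ E] [TopologicalSpace E]
  [AddCommGroup F] [Module ℂ F] [TopologicalSpace F]

/-- A linear operator is Montel if it maps bounded sets to relatively compact sets. -/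
def IsMontel (T : E →ₗ[ℂ] F) : Prop :=
  ∀ S : Set E, Bornology.IsVonNBounded ℂ S → IsCompact (closure (T '' S))

/-- A linear operator is weakly Montel if it maps bounded sets to weakly relatively compact
sets. -/
def IsWeaklyMontel (T : E →ₗ[ℂ] F) : Prop :=
  ∀ S : Set E, Bornology.IsVonNBounded ℂ S →
    IsCompact (closure (toWeakSpace ℂ F '' (T '' S)))

end

end WeightedConv

end

open WeightedConv

noncomputable section

namespace WeightedConv

variable {ω : ℕ → ℝ≥0 → ℝ}

/-! Necessity of (c). The normalised indicators `f k` of `[1, 1 + δ k]` form a bounded sequence in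
`A(ω)` and act like the point mass at `1`. The base point `1` is used because `X` fixes the point
mass there, whereas it would kill one at `0`. The images `(X (f k)) * μ` therefore converge, on
every half-line `[x, ∞)`, to the translate of `μ` by `1` (`tendsto_cconv_mulX_Ici`). If these images
lie in a weakly compact set, they have a weak cluster point `ν`. Since the weights are bounded
below, `ν ↦ ν(E)` is a continuous functional for each set `E`. Hence `ν` equals that translate and,
like all the images, vanishes on Lebesgue null sets. So the translate, and with it `μ`, is
absolutely continuous (`isAbsCont_of_weaklyCompact`).

Sufficiency of (c). If `μ` is absolutely continuous, `D̄_μ` factors through a map `B(ω) → A(ω)`, and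
it is enough that this map is Montel: composing it with the inclusion on either side gives `D_μ` and
`D̄_μ`. In the `n`-th norm, `μ` is close to `g dt` with `g` continuous of compact support. The
strong derivation condition makes the tails of `X σ` uniformly small for `σ` in a bounded set. On
the remaining bounded interval, cut into short pieces `I j`, the translates of `g` hardly change
within a piece, so the convolution depends, up to `ε`, only on the finitely many numbers `(X σ)(I
j)` (`exists_enormB_derivB_le`). These are bounded, so the image is totally bounded in every norm,
and `A(ω)` is complete (`A.isCompact_closure`). -/

/-! ### Evaluating and estimating convolutions -/

theorem cconv_apply_eq_integral (ρ μ : ComplexMeasure ℝ≥0) [IsFiniteMeasure ρ.variation]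
    {E : Set ℝ≥0} (hE : MeasurableSet E) :
    cconv ρ μ E = ρ.integral (fun s => μ ((s + ·) ⁻¹' E)) (ContinuousLinearMap.mul ℝ ℂ).flip := by
  rw [cconv, VectorMeasure.map_apply _ measurable_add hE,
    VectorMeasure.prod_apply_eq_integral (measurable_add hE)]
  rfl

/-- The value at `E` is the `ρ`-average of the translates `s ↦ μ(E - s)`, so replacing all of them
by one constant costs their mean deviation. Both halves of the proof rest on this: near the point
`1` for necessity, on short intervals for sufficiency. -/
theorem enorm_cconv_sub_le (ρ μ : ComplexMeasure ℝ≥0) [IsFiniteMeasure ρ.variation]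
    {E : Set ℝ≥0} (hE : MeasurableSet E) (c : ℂ) :
    ‖cconv ρ μ E - ρ Set.univ * c‖ₑ ≤ ∫⁻ s, ‖μ ((s + ·) ⁻¹' E) - c‖ₑ ∂ρ.variation := by
  have h1 : ρ Set.univ * c = ρ.integral (fun _ => c) (ContinuousLinearMap.mul ℝ ℂ).flip := by
    simp [mul_comm]
  have h2 : ρ.Integrable fun s => μ ((s + ·) ⁻¹' E) :=
    VectorMeasure.integrable_vectorMeasure_prodMk_left
      (s := (fun p : ℝ≥0 × ℝ≥0 => p.1 + p.2) ⁻¹' E) (measurable_add hE)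
  rw [cconv_apply_eq_integral ρ μ hE, h1, ← VectorMeasure.integral_fun_sub h2 (integrable_const c)]
  refine (VectorMeasure.enorm_integral_le_lintegral_enorm ..).trans ?_
  have h3 : ‖(ContinuousLinearMap.mul ℝ ℂ).flip‖ₑ ≤ 1 := by
    rw [← ofReal_norm, ENNReal.ofReal_le_one, ContinuousLinearMap.opNorm_flip]
    exact ContinuousLinearMap.opNorm_mul_le ℝ ℂ
  grw [h3, one_mul]

theorem enorm_cconv_restrict_sub_le (ρ μ : ComplexMeasure ℝ≥0) [IsFiniteMeasure ρ.variation]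
    {I E : Set ℝ≥0} (hI : MeasurableSet I) (hE : MeasurableSet E) {c : ℂ} {C : ℝ≥0∞}
    (h : ∀ s ∈ I, ‖μ ((s + ·) ⁻¹' E) - c‖ₑ ≤ C) :
    ‖cconv (ρ.restrict I) μ E - ρ I * c‖ₑ ≤ C * ρ.variation I := by
  have hv := VectorMeasure.variation_restrict (μ := ρ) hI
  have : IsFiniteMeasure (ρ.restrict I).variation := by rw [hv]; infer_instance
  have h1 := enorm_cconv_sub_le (ρ.restrict I) μ hE c
  rw [VectorMeasure.restrict_apply_univ, hv] at h1
  refine h1.trans ((lintegral_mono_ae (ae_restrict_of_forall_mem hI h)).trans ?_)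
  simp

theorem cconv_add_right (ν μ μ' : ComplexMeasure ℝ≥0) [IsFiniteMeasure ν.variation] :
    cconv ν (μ + μ') = cconv ν μ + cconv ν μ' := by
  rw [cconv, cconv, cconv, ← VectorMeasure.map_add]
  congr 1
  refine VectorMeasure.prod_eq_of_forall_apply_prod fun s t hs ht => ?_
  simp [VectorMeasure.prod_apply, mul_add]

/-- Each translate of a null set is null, so the integrand in `cconv_apply_eq_integral` vanishes
identically. -/
theorem isAbsCont_cconv_right {ν μ : ComplexMeasure ℝ≥0} [IsFiniteMeasure ν.variation]
    (h : IsAbsCont μ) : IsAbsCont (cconv ν μ) := by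
  rw [isAbsCont_iff] at h ⊢
  intro s hs h0
  rw [cconv_apply_eq_integral ν μ hs]
  have h1 : ∀ a : ℝ≥0, μ ((a + ·) ⁻¹' s) = 0 := fun a =>
    h _ (measurable_const_add a hs) (by simpa only [add_comm a] using lebesgue_preimage_add h0 a)
  simp only [h1]
  exact VectorMeasure.integral_zero

/-- Closed half-lines form a π-system generating the Borel sets, and `[0, ∞)` is one of them, so
total masses agree as well. -/
theorem complexMeasure_ext_Ici {ν μ : ComplexMeasure ℝ≥0}
    (h : ∀ x, ν (Set.Ici x) = μ (Set.Ici x)) : ν = μ := by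
  refine VectorMeasure.ext_of_generateFrom (Set.range Set.Ici) ?_
    ((BorelSpace.measurable_eq (α := ℝ≥0)).trans (borel_eq_generateFrom_Ici ℝ≥0)) ?_ ?_
  · rintro _ ⟨a, rfl⟩
    exact h a
  · rintro _ ⟨a, rfl⟩ _ ⟨b, rfl⟩ _
    exact ⟨a ⊔ b, Set.Ici_inter_Ici.symm⟩
  · have h0 : Set.Ici (0 : ℝ≥0) = Set.univ := Set.Ici_bot
    rw [← h0, h]

/-! ### Convergence to the translate of `μ` by `1` -/

theorem mulX_variation_le (ν : ComplexMeasure ℝ≥0) :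
    (mulX ν).variation ≤ ν.variation.withDensity fun t => ‖(t : ℝ)‖ₑ := by
  refine VectorMeasure.variation_WithDensity_le.trans ?_
  rw [VectorMeasure.variation_transpose_lsmul]

theorem lintegral_mulX_variation_le (ν : ComplexMeasure ℝ≥0) {f : ℝ≥0 → ℝ≥0∞}
    (hf : Measurable f) :
    ∫⁻ t, f t ∂(mulX ν).variation ≤ ∫⁻ t, ‖(t : ℝ)‖ₑ * f t ∂ν.variation := by
  refine (lintegral_mono' (mulX_variation_le ν) le_rfl).trans ?_
  rw [lintegral_withDensity_eq_lintegral_mul _ measurable_coe_nnreal_real.enorm hf]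
  exact le_rfl

theorem enorm_sub_one_le {t δ : ℝ≥0} (ht : t ∈ Set.Icc 1 (1 + δ)) : ‖(t : ℝ) - 1‖ₑ ≤ δ := by
  have h1 : (1 : ℝ) ≤ t := by exact_mod_cast ht.1
  have h2 : (t : ℝ) ≤ 1 + δ := by exact_mod_cast ht.2
  rw [Real.enorm_of_nonneg (by linarith), ← ENNReal.ofReal_coe_nnreal]
  exact ENNReal.ofReal_le_ofReal (by linarith)

theorem enorm_coe_le {t δ : ℝ≥0} (ht : t ∈ Set.Icc 1 (1 + δ)) : ‖(t : ℝ)‖ₑ ≤ 1 + δ := by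
  rw [Real.enorm_of_nonneg t.coe_nonneg, ENNReal.ofReal_coe_nnreal]
  exact_mod_cast ht.2

theorem enorm_apply_Ici_sub_le (μ : ComplexMeasure ℝ≥0) {a b : ℝ≥0} (hab : a ≤ b) :
    ‖μ (Set.Ici a) - μ (Set.Ici b)‖ₑ ≤ μ.variation (Set.Ico a b) := by
  have h : μ (Set.Ici a) - μ (Set.Ici b) = μ (Set.Ico a b) := by
    rw [← Set.Ico_union_Ici_eq_Ici hab, VectorMeasure.of_union _ measurableSet_Ico
      measurableSet_Ici, add_sub_cancel_right]
    exact Set.disjoint_left.2 fun x hx hx' => not_le.2 hx.2 hx'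
  rw [h]
  exact VectorMeasure.enorm_measure_le_variation _ _

/-- Two errors arise when `X ν` is replaced by a multiple of the point mass at `1`: the mass is
spread over `[1, 1 + δ]`, which moves the endpoint of the half-line by at most `δ`, and `X`
multiplies by `t` instead of `1`, which changes the total mass by a factor of order `δ`. -/
theorem enorm_cconv_mulX_Ici_sub_le (ν μ : ComplexMeasure ℝ≥0) [IsFiniteMeasure ν.variation]
    {δ : ℝ≥0} (hν : ν.variation (Set.Icc 1 (1 + δ))ᶜ = 0) (x : ℝ≥0) :
    ‖cconv (mulX ν) μ (Set.Ici x) - ν Set.univ * μ (Set.Ici (x - 1))‖ₑ ≤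
      ν.variation Set.univ * ((1 + δ) * μ.variation (Set.Ico (x - (1 + δ)) (x - 1))
        + δ * ‖μ (Set.Ici (x - 1))‖ₑ) := by
  have hae : ∀ᵐ t ∂ν.variation, t ∈ Set.Icc 1 (1 + δ) := hν
  have hint : ν.Integrable fun t : ℝ≥0 => (t : ℝ) := by
    refine Integrable.of_bound (measurable_coe_nnreal_real.aestronglyMeasurable) (1 + δ) ?_
    filter_upwards [hae] with t ht
    rw [Real.norm_of_nonneg t.coe_nonneg]
    exact_mod_cast ht.2
  set ρ := mulX ν with hρ
  have hρv : ρ.variation Set.univ ≤ (1 + δ) * ν.variation Set.univ := by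
    have h1 := lintegral_mulX_variation_le ν (f := fun _ => 1) measurable_const
    simp only [lintegral_one, mul_one] at h1
    refine h1.trans ((lintegral_mono_ae (hae.mono fun t ht => enorm_coe_le ht)).trans ?_)
    simp
  have : IsFiniteMeasure ρ.variation := ⟨hρv.trans_lt <| ENNReal.mul_lt_top
    (by finiteness) (measure_lt_top _ _)⟩
  have hρae : ∀ᵐ t ∂ρ.variation, t ∈ Set.Icc 1 (1 + δ) :=
    (Measure.absolutelyContinuous_of_le (mulX_variation_le ν)).trans
      (withDensity_absolutelyContinuous _ _) hae
  set D := μ.variation (Set.Ico (x - (1 + δ)) (x - 1))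
  have h1 : ‖cconv ρ μ (Set.Ici x) - ρ Set.univ * μ (Set.Ici (x - 1))‖ₑ
      ≤ D * ((1 + δ) * ν.variation Set.univ) := by
    refine (enorm_cconv_sub_le ρ μ measurableSet_Ici _).trans ?_
    have h2 : ∀ᵐ s ∂ρ.variation, ‖μ ((s + ·) ⁻¹' Set.Ici x) - μ (Set.Ici (x - 1))‖ₑ ≤ D := by
      filter_upwards [hρae] with s hs
      -- Truncated subtraction is right here: for `s ≥ x` both sides are all of `[0, ∞)`.
      have h3 : (s + ·) ⁻¹' Set.Ici x = Set.Ici (x - s) := by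
        ext t
        simp [add_comm s]
      rw [h3]
      refine (enorm_apply_Ici_sub_le μ (tsub_le_tsub_left hs.1 x)).trans (measure_mono ?_)
      exact Set.Ico_subset_Ico_left (tsub_le_tsub_left hs.2 x)
    refine (lintegral_mono_ae h2).trans ?_
    rw [lintegral_const]
    gcongr
  have h2 : ‖ρ Set.univ - ν Set.univ‖ₑ ≤ δ * ν.variation Set.univ := by
    have h3 : ν Set.univ = ν.integral (fun _ => (1 : ℝ)) (ContinuousLinearMap.lsmul ℝ ℝ) := by
      simp
    rw [h3, hρ, mulX, VectorMeasure.withDensity_apply_univ,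
      ← VectorMeasure.integral_fun_sub hint (integrable_const _)]
    refine (VectorMeasure.enorm_integral_le_lintegral_enorm ..).trans ?_
    have h4 : ‖(ContinuousLinearMap.lsmul ℝ ℝ : ℝ →L[ℝ] ℂ →L[ℝ] ℂ)‖ₑ ≤ 1 := by
      rw [← ofReal_norm, ENNReal.ofReal_le_one]
      exact ContinuousLinearMap.opNorm_lsmul_le
    grw [h4, one_mul]
    refine (lintegral_mono_ae (hae.mono fun t ht => enorm_sub_one_le ht)).trans ?_
    simp
  calc _ = ‖(cconv ρ μ (Set.Ici x) - ρ Set.univ * μ (Set.Ici (x - 1)))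
        + (ρ Set.univ - ν Set.univ) * μ (Set.Ici (x - 1))‖ₑ := by congr 1; ring
    _ ≤ D * ((1 + δ) * ν.variation Set.univ)
        + δ * ν.variation Set.univ * ‖μ (Set.Ici (x - 1))‖ₑ := by
        refine (enorm_add_le _ _).trans ?_
        rw [enorm_mul]
        gcongr
    _ = _ := by ring

/-- The intervals exclude their right endpoint and so shrink to the empty set. Because the
approximating masses lie to the right of `1` and the half-lines are closed, no atom of `μ`
interferes and convergence holds at every `x`. -/
theorem tendsto_variation_Ico_sub (μ : ComplexMeasure ℝ≥0) [IsFiniteMeasure μ.variation]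
    {δ : ℕ → ℝ≥0} (hδ : Antitone δ) (hδ0 : Tendsto δ atTop (𝓝 0)) (x : ℝ≥0) :
    Tendsto (fun k => μ.variation (Set.Ico (x - (1 + δ k)) (x - 1))) atTop (𝓝 0) := by
  have h1 : ⋂ k, Set.Ico (x - (1 + δ k)) (x - 1) = ∅ := by
    refine Set.eq_empty_of_forall_notMem fun t ht => ?_
    rw [Set.mem_iInter] at ht
    refine (ht 0).2.not_ge (ge_of_tendsto (f := fun k => t + δ k) ?_ (x := atTop)
      (Eventually.of_forall fun k => ?_))
    · simpa using hδ0.const_add t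
    · have h2 := (ht k).1
      rw [tsub_le_iff_right] at h2 ⊢
      exact h2.trans (le_of_eq (by ring))
  have h2 := tendsto_measure_iInter_atTop (μ := μ.variation)
    (s := fun k => Set.Ico (x - (1 + δ k)) (x - 1))
    (fun k => measurableSet_Ico.nullMeasurableSet)
    (fun i j hij => Set.Ico_subset_Ico_left (tsub_le_tsub_left (by gcongr; exact hδ hij) x))
    ⟨0, by finiteness⟩
  rwa [h1, measure_empty] at h2

theorem tendsto_cconv_mulX_Ici (ν : ℕ → ComplexMeasure ℝ≥0) (μ : ComplexMeasure ℝ≥0)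
    [IsFiniteMeasure μ.variation] {δ : ℕ → ℝ≥0} (hδ : Antitone δ) (hδ0 : Tendsto δ atTop (𝓝 0))
    (h1 : ∀ k, ν k Set.univ = 1) (h2 : ∀ k, (ν k).variation Set.univ ≤ 1)
    (h3 : ∀ k, (ν k).variation (Set.Icc 1 (1 + δ k))ᶜ = 0) (x : ℝ≥0) :
    Tendsto (fun k => cconv (mulX (ν k)) μ (Set.Ici x)) atTop (𝓝 (μ (Set.Ici (x - 1)))) := by
  rw [tendsto_iff_edist_tendsto_0]
  have hδ' : Tendsto (fun k => (δ k : ℝ≥0∞)) atTop (𝓝 0) := by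
    simpa using ENNReal.tendsto_coe.2 hδ0
  have h4 : Tendsto (fun k => (1 + (δ k : ℝ≥0∞)) *
      μ.variation (Set.Ico (x - (1 + δ k)) (x - 1)) + δ k * ‖μ (Set.Ici (x - 1))‖ₑ) atTop
      (𝓝 ((1 + 0) * 0 + 0 * ‖μ (Set.Ici (x - 1))‖ₑ)) := by
    refine Tendsto.add (ENNReal.Tendsto.mul (hδ'.const_add 1) (by simp)
      (tendsto_variation_Ico_sub μ hδ hδ0 x) (by simp))
      (ENNReal.Tendsto.mul hδ' (by simp) tendsto_const_nhds (by simp))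
  rw [mul_zero, zero_mul, add_zero] at h4
  refine tendsto_of_tendsto_of_tendsto_of_le_of_le tendsto_const_nhds h4 (fun k => zero_le)
    fun k => ?_
  have : IsFiniteMeasure (ν k).variation := ⟨(h2 k).trans_lt ENNReal.one_lt_top⟩
  have h5 := enorm_cconv_mulX_Ici_sub_le (ν k) μ (h3 k) x
  rw [h1 k, one_mul] at h5
  change edist _ _ ≤ _
  rw [edist_eq_enorm_sub]
  refine h5.trans ((mul_le_mul_left (h2 k) _).trans_eq (one_mul _))

/-! ### Seminorms and evaluation functionals -/

theorem seminormB_apply (n : ℕ) (ν : B ω) :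
    seminormB ω n ν = (enormB ω n ν.toMeasure).toReal := rfl

theorem enormB_lt_top (ν : B ω) (n : ℕ) : enormB ω n ν.toMeasure < ∞ := ν.2 n

theorem ofReal_seminormB (n : ℕ) (ν : B ω) :
    ENNReal.ofReal (seminormB ω n ν) = enormB ω n ν.toMeasure :=
  ENNReal.ofReal_toReal (enormB_lt_top ν n).ne

theorem seminormB_incl (hω : IsWeightSequence ω) (n : ℕ) (f : A ω) :
    seminormB ω n (incl hω f) = seminormA ω n f := by
  rw [seminormB_apply, incl_toMeasure, enormB_withDensity hω (f.integrable hω)]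
  exact (integral_norm_eq_lintegral_enorm (f.integrable_mul n).aestronglyMeasurable).symm

/-- The inclusion `A(ω) ⊆ B(ω)` as a continuous linear map. -/
def inclCLM (hω : IsWeightSequence ω) : A ω →L[ℂ] B ω where
  toLinearMap := incl hω
  cont := (withSeminorms_B ω).continuous_of_continuous_comp _ fun n => by
    refine ((withSeminorms_A ω).continuous_seminorm n).congr fun f => ?_
    exact (seminormB_incl hω n f).symm

theorem isVonNBounded_incl_image (hω : IsWeightSequence ω) {S : Set (A ω)}
    (hS : Bornology.IsVonNBounded ℂ S) : Bornology.IsVonNBounded ℂ (incl hω '' S) :=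
  hS.image (inclCLM hω)

/-- A lower bound for the weight controls the total variation; this makes evaluation at any set a
continuous functional. -/
theorem norm_apply_le_seminormB {n : ℕ} {c : ℝ} (hc : 0 < c)
    (hc' : ∀ t, c ≤ ω n t) (ν : B ω) (E : Set ℝ≥0) :
    ‖ν.toMeasure E‖ ≤ c⁻¹ * seminormB ω n ν := by
  have h1 : ENNReal.ofReal c * ν.toMeasure.variation Set.univ ≤ enormB ω n ν.toMeasure := by
    rw [← lintegral_const]
    exact lintegral_mono fun t => ENNReal.ofReal_le_ofReal (hc' t)
  have h2 : ENNReal.ofReal (c * ‖ν.toMeasure E‖) ≤ enormB ω n ν.toMeasure := by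
    rw [ENNReal.ofReal_mul hc.le, ofReal_norm]
    refine le_trans ?_ h1
    gcongr
    exact (VectorMeasure.enorm_measure_le_variation _ _).trans (measure_mono (Set.subset_univ E))
  rw [← ofReal_seminormB, ENNReal.ofReal_le_ofReal_iff (apply_nonneg _ _)] at h2
  rwa [inv_mul_eq_div, le_div_iff₀' hc]

/-- The linear functional `ν ↦ ν(E)` on `B(ω)`. -/
def evalLinear (E : Set ℝ≥0) : B ω →ₗ[ℂ] ℂ where
  toFun ν := ν.toMeasure E
  map_add' ν μ := by rw [map_add]; rfl
  map_smul' c ν := by rw [map_smul]; rfl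

/-- The continuous linear functional `ν ↦ ν(E)` on `B(ω)`. -/
def evalCLM (hω : IsWeightSequence ω) (E : Set ℝ≥0) : B ω →L[ℂ] ℂ where
  toLinearMap := evalLinear E
  cont := by
    obtain ⟨c, hc, hc'⟩ := hω.exists_lower_bound 0
    refine (withSeminorms_B ω).continuous_normedSpace_rng ℂ (evalLinear E)
      ⟨{0}, ⟨c⁻¹, by positivity⟩, fun ν => ?_⟩
    rw [Finset.sup_singleton]
    exact norm_apply_le_seminormB hc hc' ν E

/-! ### An approximate identity at the point `1` -/

theorem lebesgue_Icc (a b : ℝ≥0) : lebesgue (Set.Icc a b) = ENNReal.ofReal (b - a) := by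
  rw [lebesgue, measurableEmbedding_coe.comap_apply]
  have : ((↑) : ℝ≥0 → ℝ) '' Set.Icc a b = Set.Icc (a : ℝ) b := by
    ext x
    constructor
    · rintro ⟨t, ht, rfl⟩
      exact ⟨ht.1, ht.2⟩
    · intro hx
      exact ⟨⟨x, a.2.trans hx.1⟩, ⟨hx.1, hx.2⟩, rfl⟩
  rw [this, Real.volume_Icc]

/-- An integrable function vanishing outside `[0, T]` defines an element of `A(ω)`. -/
theorem exists_incl_eq_withDensity (hω : IsWeightSequence ω) {g : ℝ≥0 → ℂ}
    (hg : Integrable g lebesgue) {T : ℝ≥0} (hT : ∀ t, T < t → g t = 0) :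
    ∃ f : A ω, (incl hω f).toMeasure = lebesgue.withDensityᵥ g ∧
      ∀ n C, (∀ t ≤ T, ω n t ≤ C) →
        seminormA ω n f ≤ C * (∫⁻ t, ‖g t‖ₑ ∂lebesgue).toReal := by
  have h1 : ∀ n C, (∀ t ≤ T, ω n t ≤ C) →
      enormB ω n (lebesgue.withDensityᵥ g) ≤ ENNReal.ofReal C * ∫⁻ t, ‖g t‖ₑ ∂lebesgue := by
    intro n C hC
    rw [enormB_withDensity hω hg, ← lintegral_const_mul' _ _ ENNReal.ofReal_ne_top]
    refine lintegral_mono fun t => ?_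
    rcases le_or_gt t T with h | h
    · rw [enorm_mul, mul_comm]
      gcongr
      rw [← ofReal_norm, Complex.norm_real, Real.norm_of_nonneg ((hω.weight n).pos t).le]
      exact ENNReal.ofReal_le_ofReal (hC t h)
    · simp [hT t h]
  let ν : B ω := ⟨lebesgue.withDensityᵥ g, fun n => by
    obtain ⟨C, hC⟩ := (hω.weight n).locallyBounded T
    exact (h1 n C hC).trans_lt (ENNReal.mul_lt_top ENNReal.ofReal_lt_top hg.2)⟩
  have hν : IsAbsCont ν.toMeasure := by
    rw [isAbsCont_iff]
    intro s hs h0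
    change lebesgue.withDensityᵥ g s = 0
    rw [withDensityᵥ_apply hg hs, Measure.restrict_zero_set h0, integral_zero_measure]
  obtain ⟨f, hf⟩ := mem_range_incl hω hν
  refine ⟨f, by rw [hf]; rfl, fun n C hC => ?_⟩
  have hC0 : 0 ≤ C := ((hω.weight n).pos 0).le.trans (hC 0 zero_le)
  rw [← seminormB_incl hω, hf, seminormB_apply, ← ENNReal.toReal_ofReal hC0,
    ← ENNReal.toReal_mul]
  exact ENNReal.toReal_mono (ENNReal.mul_lt_top ENNReal.ofReal_lt_top hg.2).ne (h1 n C hC)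

/-- There is a bounded approximate identity at the point `1` in `A(ω)`. -/
theorem exists_approx_dirac_one (hω : IsWeightSequence ω) :
    ∃ (f : ℕ → A ω) (δ : ℕ → ℝ≥0), Bornology.IsVonNBounded ℂ (Set.range f) ∧
      Antitone δ ∧ Tendsto δ atTop (𝓝 0) ∧
      (∀ k, (incl hω (f k)).toMeasure Set.univ = 1) ∧
      (∀ k, (incl hω (f k)).toMeasure.variation Set.univ ≤ 1) ∧
      ∀ k, (incl hω (f k)).toMeasure.variation (Set.Icc 1 (1 + δ k))ᶜ = 0 := by
  set δ : ℕ → ℝ≥0 := fun k => 1 / ((k : ℝ≥0) + 1) with hδ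
  have hδpos : ∀ k, 0 < δ k := fun k => by positivity
  have hδanti : Antitone δ := fun i j hij => by
    simp only [hδ]
    gcongr
  have hδ1 : ∀ k, δ k ≤ 1 := fun k => by
    simp [hδ]
  set g : ℕ → ℝ≥0 → ℂ := fun k => (Set.Icc 1 (1 + δ k)).indicator fun _ => (((δ k)⁻¹ : ℝ≥0) : ℂ)
    with hg
  have hvol : ∀ k, lebesgue (Set.Icc 1 (1 + δ k)) = δ k := fun k => by
    rw [lebesgue_Icc, NNReal.coe_add, add_sub_cancel_left, ENNReal.ofReal_coe_nnreal]
  have hgint : ∀ k, Integrable (g k) lebesgue := fun k => by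
    refine (integrable_indicator_iff measurableSet_Icc).2 (integrableOn_const ?_)
    rw [hvol]
    exact ENNReal.coe_ne_top
  have hgl : ∀ k, ∫⁻ t, ‖g k t‖ₑ ∂lebesgue = 1 := fun k => by
    simp only [hg, enorm_indicator_eq_indicator_enorm]
    rw [lintegral_indicator measurableSet_Icc, setLIntegral_const, hvol]
    have : ‖(((δ k)⁻¹ : ℝ≥0) : ℂ)‖ₑ = ((δ k)⁻¹ : ℝ≥0) := by
      rw [← ofReal_norm, Complex.norm_real, Real.norm_of_nonneg (NNReal.coe_nonneg _),
        ENNReal.ofReal_coe_nnreal]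
    rw [this, ← ENNReal.coe_mul, inv_mul_cancel₀ (hδpos k).ne', ENNReal.coe_one]
  have hgT : ∀ k t, 2 < t → g k t = 0 := fun k t ht => by
    refine Set.indicator_of_notMem (fun h => ht.not_ge (h.2.trans ?_)) _
    have := add_le_add_right (hδ1 k) 1
    exact this.trans_eq (by norm_num)
  -- All supports lie in `[0, 2]`, where each weight is bounded; with unit `L¹` norms this makes the
  -- sequence bounded in `A(ω)`.
  choose f hf1 hf2 using fun k => exists_incl_eq_withDensity hω (hgint k) (hgT k)
  have hvar : ∀ k, (incl hω (f k)).toMeasure.variation = lebesgue.withDensity (‖g k ·‖ₑ) :=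
    fun k => by rw [hf1, Measure.variation_withDensityᵥ (hgint k)]
  refine ⟨f, δ, ?_, hδanti, ?_, fun k => ?_, fun k => ?_, fun k => ?_⟩
  · rw [(withSeminorms_A ω).isVonNBounded_iff_seminorm_bddAbove]
    intro n
    obtain ⟨C, hC⟩ := (hω.weight n).locallyBounded 2
    refine ⟨C, ?_⟩
    rintro _ ⟨_, ⟨k, rfl⟩, rfl⟩
    have := hf2 k n C hC
    rwa [hgl k, ENNReal.toReal_one, mul_one] at this
  · exact tendsto_one_div_add_atTop_nhds_zero_nat
  · rw [hf1, withDensityᵥ_apply (hgint k) MeasurableSet.univ, setIntegral_univ,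
      integral_indicator measurableSet_Icc, setIntegral_const, measureReal_def, hvol]
    have := (hδpos k).ne'
    simp [this]
  · rw [hvar, withDensity_apply _ MeasurableSet.univ, setLIntegral_univ, hgl]
  · rw [hvar, withDensity_apply _ measurableSet_Icc.compl]
    refine (setLIntegral_congr_fun measurableSet_Icc.compl (g := fun _ => 0) fun t ht => ?_).trans
      lintegral_zero
    simp [hg, Set.indicator_of_notMem ht]

/-! ### Weak compactness forces absolute continuity -/

theorem isAbsCont_of_map_add_one {μ : ComplexMeasure ℝ≥0}
    (h : IsAbsCont (μ.map (· + 1))) : IsAbsCont μ := by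
  rw [isAbsCont_iff] at h ⊢
  intro s hs h0
  have hemb : MeasurableEmbedding fun t : ℝ≥0 => t + 1 :=
    (Topology.IsClosedEmbedding.measurableEmbedding
      (((isometry_iff_dist_eq (f := fun t : ℝ≥0 => t + 1)).2 fun a b => by
        simp [NNReal.dist_eq]).isClosedEmbedding))
  have h1 : lebesgue ((fun t : ℝ≥0 => t + 1) '' s) = 0 := by
    rw [lebesgue, measurableEmbedding_coe.comap_apply] at h0 ⊢
    have h2 := measure_preimage_add_right (volume : Measure ℝ) (-1) (((↑) : ℝ≥0 → ℝ) '' s)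
    rw [h0] at h2
    refine measure_mono_null ?_ h2
    rintro _ ⟨_, ⟨t, ht, rfl⟩, rfl⟩
    exact ⟨t, ht, by simp⟩
  have h2 := h _ (hemb.measurableSet_image.2 hs) h1
  rwa [VectorMeasure.map_apply _ hemb.measurable (hemb.measurableSet_image.2 hs),
    Set.preimage_image_eq _ hemb.injective] at h2

/-- If the images under `D̄_μ` of bounded sequences in `A(ω)` lie in weakly compact subsets
of `B(ω)`, then `μ` is absolutely continuous. -/
theorem isAbsCont_of_weaklyCompact (hω : IsWeightSequence ω) (hc : DerivationCondition ω)
    (μ : B ω) (h : ∀ f : ℕ → A ω, Bornology.IsVonNBounded ℂ (Set.range f) →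
      ∃ K : Set (WeakSpace ℂ (B ω)), IsCompact K ∧
        ∀ k, toWeakSpace ℂ (B ω) (derivB hω hc μ (incl hω (f k))) ∈ K) :
    IsAbsCont μ.toMeasure := by
  have : IsFiniteMeasure μ.toMeasure.variation := hω.isFiniteMeasure (μ.2 0)
  obtain ⟨f, δ, hf, hδ, hδ0, h1, h2, h3⟩ := exists_approx_dirac_one hω
  obtain ⟨K, hK, hfK⟩ := h f hf
  obtain ⟨x, -, hx⟩ := hK.exists_mapClusterPt (f := atTop)
    (u := fun k => toWeakSpace ℂ (B ω) (derivB hω hc μ (incl hω (f k))))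
    (tendsto_principal.2 (Eventually.of_forall hfK))
  obtain ⟨ν, rfl⟩ := (toWeakSpace ℂ (B ω)).surjective x
  -- The value of `ν` at `E` is a cluster point of the values along the sequence, so it is their
  -- limit whenever one exists.
  have key : ∀ (E : Set ℝ≥0) (a : ℂ), Tendsto
      (fun k => (derivB hω hc μ (incl hω (f k))).toMeasure E) atTop (𝓝 a) →
      ν.toMeasure E = a := by
    intro E a ha
    have hcont : Continuous fun y : WeakSpace ℂ (B ω) => evalCLM hω E ((toWeakSpace ℂ (B ω)).symm y) :=
      WeakBilin.eval_continuous _ (evalCLM hω E)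
    obtain ⟨φ, hφ, hφ'⟩ := (hx.continuousAt_comp hcont.continuousAt).tendsto_subseq
    exact tendsto_nhds_unique hφ' (ha.comp hφ.tendsto_atTop)
  have hν : IsAbsCont ν.toMeasure := by
    rw [isAbsCont_iff]
    intro s hs h0
    refine key s 0 (tendsto_const_nhds.congr fun k => ?_)
    obtain ⟨g, hg⟩ := derivB_incl_mem hω hc μ (f k)
    have := isAbsCont_incl hω g
    rw [hg, isAbsCont_iff] at this
    exact (this s hs h0).symm
  -- The limits on half-lines identify the cluster point as the translate of `μ`.
  have hνμ : μ.toMeasure.map (· + 1) = ν.toMeasure := by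
    refine complexMeasure_ext_Ici fun x => ?_
    rw [key (Set.Ici x) _ (tendsto_cconv_mulX_Ici (fun k => (incl hω (f k)).toMeasure) μ.toMeasure
      hδ hδ0 h1 h2 h3 x), VectorMeasure.map_apply _ (measurable_add_const 1) measurableSet_Ici]
    congr 1
    ext t
    simp
  exact isAbsCont_of_map_add_one (hνμ ▸ hν)

/-! ### Translates of a density -/

instance : IsLocallyFiniteMeasure lebesgue := by
  refine ⟨fun x => ⟨Set.Iic (x + 1), Iic_mem_nhds (lt_add_one x), ?_⟩⟩
  rw [← Set.Icc_bot, lebesgue_Icc]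
  exact ENNReal.ofReal_lt_top

theorem map_const_add_lebesgue (s : ℝ≥0) :
    lebesgue.map (s + ·) = lebesgue.restrict (Set.Ici s) := by
  ext E hE
  rw [Measure.map_apply (measurable_const_add s) hE, Measure.restrict_apply hE, lebesgue,
    measurableEmbedding_coe.comap_apply, measurableEmbedding_coe.comap_apply,
    ← measure_preimage_add (volume : Measure ℝ) (s : ℝ) (((↑) : ℝ≥0 → ℝ) '' (E ∩ Set.Ici s))]
  congr 1
  ext x
  constructor
  · rintro ⟨t, ht, rfl⟩
    exact ⟨s + t, ⟨ht, Set.mem_Ici.2 le_self_add⟩, NNReal.coe_add s t⟩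
  · rintro ⟨u, ⟨hu, hu'⟩, hux⟩
    have h1 : ((u - s : ℝ≥0) : ℝ) = x := by
      rw [NNReal.coe_sub hu', hux]
      simp
    refine ⟨u - s, ?_, h1⟩
    change s + (u - s) ∈ E
    rwa [add_tsub_cancel_of_le hu']

/-- The translate of `g` by `s` to the right, extended by zero. -/
def rightShift (g : ℝ≥0 → ℂ) (s : ℝ≥0) : ℝ≥0 → ℂ := (Set.Ici s).indicator fun u => g (u - s)

theorem rightShift_add (g : ℝ≥0 → ℂ) (s t : ℝ≥0) : rightShift g s (s + t) = g t := by
  simp [rightShift]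

theorem measurable_rightShift {g : ℝ≥0 → ℂ} (hg : Continuous g) (s : ℝ≥0) :
    Measurable (rightShift g s) :=
  Measurable.indicator (hg.comp (continuous_id.sub continuous_const)).measurable measurableSet_Ici

theorem enorm_rightShift_le {g : ℝ≥0 → ℂ} {M : ℝ≥0} (hM : ∀ t, ‖g t‖ₑ ≤ M) (s u : ℝ≥0) :
    ‖rightShift g s u‖ₑ ≤ M := by
  rw [rightShift, enorm_indicator_eq_indicator_enorm]
  exact Set.indicator_le' (fun _ _ => hM _) (fun _ _ => zero_le) u

theorem rightShift_eq_zero {g : ℝ≥0 → ℂ} {R R' s u : ℝ≥0} (hR : ∀ t, R < t → g t = 0)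
    (hs : s + R ≤ R') (hu : R' < u) : rightShift g s u = 0 := by
  rw [rightShift, Set.indicator_apply_eq_zero]
  intro _
  exact hR _ (lt_tsub_iff_left.2 (hs.trans_lt hu))

theorem enorm_rightShift_le_indicator {g : ℝ≥0 → ℂ} {M : ℝ≥0} (hM : ∀ t, ‖g t‖ₑ ≤ M)
    {R R' s : ℝ≥0} (hR : ∀ t, R < t → g t = 0) (hs : s + R ≤ R') (u : ℝ≥0) :
    ‖rightShift g s u‖ₑ ≤ (Set.Iic R').indicator (fun _ => (M : ℝ≥0∞)) u := by
  by_cases hu : u ∈ Set.Iic R'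
  · rw [Set.indicator_of_mem hu]
    exact enorm_rightShift_le hM s u
  · rw [Set.indicator_of_notMem hu, rightShift_eq_zero hR hs (not_le.1 hu), enorm_zero]

theorem integrable_rightShift {g : ℝ≥0 → ℂ} (hg : Continuous g) (hgi : Integrable g lebesgue)
    (s : ℝ≥0) : Integrable (rightShift g s) lebesgue := by
  have h1 : Integrable (rightShift g s) (lebesgue.map (s + ·)) := by
    rw [integrable_map_measure (measurable_rightShift hg s).aestronglyMeasurable
      (measurable_const_add s).aemeasurable]
    exact hgi.congr (Eventually.of_forall fun t => (rightShift_add g s t).symm)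
  rw [map_const_add_lebesgue] at h1
  rw [rightShift, integrable_indicator_iff measurableSet_Ici]
  refine h1.congr ?_
  filter_upwards [ae_restrict_mem measurableSet_Ici] with u hu
  rw [rightShift, Set.indicator_of_mem hu]

/-- Moving the translation from the set to the density lets translates by different `s` be compared
pointwise over the same `E`. -/
theorem withDensity_preimage_add {g : ℝ≥0 → ℂ} (hg : Continuous g) (hgi : Integrable g lebesgue)
    (s : ℝ≥0) {E : Set ℝ≥0} (hE : MeasurableSet E) :
    lebesgue.withDensityᵥ g ((s + ·) ⁻¹' E) = ∫ u in E, rightShift g s u ∂lebesgue := by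
  rw [withDensityᵥ_apply hgi (measurable_const_add s hE)]
  have h1 := setIntegral_map (μ := lebesgue) hE
    (measurable_rightShift hg s).aestronglyMeasurable (measurable_const_add s).aemeasurable
  simp only [rightShift_add] at h1
  rw [← h1, map_const_add_lebesgue, Measure.restrict_restrict hE, rightShift,
    setIntegral_indicator measurableSet_Ici, setIntegral_indicator measurableSet_Ici,
    Set.inter_assoc, Set.inter_self]

/-- Where both translates are active, uniform continuity gives `ε`. Since `g(0)` need not be `0`,
extension by zero creates a jump; between `s₀` and `s` only the bound `M` is available, but this set
lies in an interval of length `δ`. -/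
theorem enorm_rightShift_sub_le {g : ℝ≥0 → ℂ} {M ε δ R R' s₀ s : ℝ≥0} (hM : ∀ t, ‖g t‖ₑ ≤ M)
    (hR : ∀ t, R < t → g t = 0) (hδ : ∀ a b : ℝ≥0, dist a b < δ → dist (g a) (g b) < ε)
    (hs : s ∈ Set.Ico s₀ (s₀ + δ)) (hR' : s₀ + δ + R ≤ R') (u : ℝ≥0) :
    ‖rightShift g s u - rightShift g s₀ u‖ₑ ≤ (Set.Iic R').indicator (fun _ => (ε : ℝ≥0∞)) u
      + (Set.Ico s₀ (s₀ + δ)).indicator (fun _ => (M : ℝ≥0∞)) u := by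
  rcases lt_or_ge R' u with hu | hu
  · rw [rightShift_eq_zero hR ((add_le_add_left hs.2.le R).trans hR') hu,
      rightShift_eq_zero hR ((add_le_add_left le_self_add R).trans hR') hu]
    simp
  rcases lt_or_ge u s with hus | hus
  · have h1 : rightShift g s u = 0 := Set.indicator_of_notMem (not_le.2 hus) _
    rw [h1, zero_sub, enorm_neg]
    refine le_add_left ?_
    rcases lt_or_ge u s₀ with hu0 | hu0
    · have h2 : rightShift g s₀ u = 0 := Set.indicator_of_notMem (not_le.2 hu0) _
      simp [h2]
    · rw [Set.indicator_of_mem (Set.mem_Ico.2 ⟨hu0, hus.trans hs.2⟩)]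
      exact enorm_rightShift_le hM _ _
  · refine le_add_right ?_
    rw [Set.indicator_of_mem (Set.mem_Iic.2 hu), rightShift, rightShift,
      Set.indicator_of_mem (Set.mem_Ici.2 hus),
      Set.indicator_of_mem (Set.mem_Ici.2 (hs.1.trans hus)), ← edist_eq_enorm_sub, edist_dist,
      ← ENNReal.ofReal_coe_nnreal]
    refine ENNReal.ofReal_le_ofReal (hδ _ _ ?_).le
    rw [NNReal.dist_eq, NNReal.coe_sub hus, NNReal.coe_sub (hs.1.trans hus),
      sub_sub_sub_cancel_left, abs_sub_comm, abs_of_nonneg]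
    · have := hs.2
      rw [← NNReal.coe_lt_coe, NNReal.coe_add] at this
      linarith
    · have := NNReal.coe_le_coe.2 hs.1
      linarith

/-! ### Convolution with a compactly supported density -/

/-- On a short interval `I` the measure `ρ` is compared with mass `ρ(I)` placed at the left
endpoint. The first summand is the error of this comparison, the second the contribution of the
single number `ρ(I)`. A bound by measures, not only by total mass, is needed in order to integrate
weights. -/
theorem variation_cconv_restrict_le {g : ℝ≥0 → ℂ} (hg : Continuous g)
    (hgi : Integrable g lebesgue) {M ε δ R R' s₀ : ℝ≥0} (hM : ∀ t, ‖g t‖ₑ ≤ M)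
    (hR : ∀ t, R < t → g t = 0) (hδ : ∀ a b : ℝ≥0, dist a b < δ → dist (g a) (g b) < ε)
    (hR' : s₀ + δ + R ≤ R') (ρ : ComplexMeasure ℝ≥0) [IsFiniteMeasure ρ.variation] :
    (cconv (ρ.restrict (Set.Ico s₀ (s₀ + δ))) (lebesgue.withDensityᵥ g)).variation ≤
      (ρ.variation (Set.Ico s₀ (s₀ + δ))) • ((ε : ℝ≥0∞) • lebesgue.restrict (Set.Iic R')
        + (M : ℝ≥0∞) • lebesgue.restrict (Set.Ico s₀ (s₀ + δ)))
      + (‖ρ (Set.Ico s₀ (s₀ + δ))‖ₑ * M) • lebesgue.restrict (Set.Iic R') := by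
  set I := Set.Ico s₀ (s₀ + δ)
  refine VectorMeasure.variation_le_of_forall_enorm_le fun E hE => ?_
  set c := lebesgue.withDensityᵥ g ((s₀ + ·) ⁻¹' E) with hcdef
  have hc : ‖c‖ₑ ≤ M * lebesgue.restrict (Set.Iic R') E := by
    rw [hcdef, withDensity_preimage_add hg hgi s₀ hE]
    refine (enorm_integral_le_lintegral_enorm _).trans ?_
    refine (lintegral_mono (enorm_rightShift_le_indicator hM hR
      ((add_le_add_left le_self_add R).trans hR'))).trans ?_
    rw [lintegral_indicator measurableSet_Iic, lintegral_const,
      Measure.restrict_restrict measurableSet_Iic, Measure.restrict_apply MeasurableSet.univ,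
      Measure.restrict_apply hE, Set.univ_inter, Set.inter_comm]
  have h1 : ∀ s ∈ I, ‖lebesgue.withDensityᵥ g ((s + ·) ⁻¹' E) - c‖ₑ ≤
      ε * lebesgue.restrict (Set.Iic R') E + M * lebesgue.restrict I E := by
    intro s hs
    rw [hcdef, withDensity_preimage_add hg hgi s hE, withDensity_preimage_add hg hgi s₀ hE,
      ← integral_sub (integrable_rightShift hg hgi s).integrableOn
        (integrable_rightShift hg hgi s₀).integrableOn]
    refine (enorm_integral_le_lintegral_enorm _).trans ?_
    refine (lintegral_mono (enorm_rightShift_sub_le hM hR hδ hs hR')).trans ?_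
    rw [lintegral_add_left (measurable_const.indicator measurableSet_Iic),
      lintegral_indicator measurableSet_Iic, lintegral_const,
      lintegral_indicator measurableSet_Ico, lintegral_const,
      Measure.restrict_restrict measurableSet_Iic, Measure.restrict_restrict measurableSet_Ico,
      Measure.restrict_apply MeasurableSet.univ, Measure.restrict_apply MeasurableSet.univ,
      Measure.restrict_apply hE, Measure.restrict_apply hE, Set.univ_inter, Set.univ_inter,
      Set.inter_comm, Set.inter_comm I]
  have h2 := enorm_cconv_restrict_sub_le ρ (lebesgue.withDensityᵥ g) measurableSet_Ico hE h1
  set κ := cconv (ρ.restrict I) (lebesgue.withDensityᵥ g)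
  calc ‖κ E‖ₑ = ‖(κ E - ρ I * c) + ρ I * c‖ₑ := by rw [sub_add_cancel]
    _ ≤ _ := enorm_add_le _ _
    _ ≤ (ε * lebesgue.restrict (Set.Iic R') E + M * lebesgue.restrict I E) * ρ.variation I
        + ‖ρ I‖ₑ * (M * lebesgue.restrict (Set.Iic R') E) := by
        rw [enorm_mul (ρ I)]
        gcongr
    _ = _ := by
        simp only [Measure.add_apply, Measure.smul_apply, smul_eq_mul]
        ring

theorem enormB_cconv_restrict_le (n : ℕ) {g : ℝ≥0 → ℂ} (hg : Continuous g)
    (hgi : Integrable g lebesgue) {M ε δ R R' s₀ W : ℝ≥0} (hM : ∀ t, ‖g t‖ₑ ≤ M)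
    (hR : ∀ t, R < t → g t = 0) (hδ : ∀ a b : ℝ≥0, dist a b < δ → dist (g a) (g b) < ε)
    (hR' : s₀ + δ + R ≤ R') (hW : ∀ t ≤ R', ω n t ≤ W)
    (ρ : ComplexMeasure ℝ≥0) [IsFiniteMeasure ρ.variation] :
    enormB ω n (cconv (ρ.restrict (Set.Ico s₀ (s₀ + δ))) (lebesgue.withDensityᵥ g)) ≤
      (W * (ε * R' + M * δ)) * ρ.variation (Set.Ico s₀ (s₀ + δ))
        + (W * M * R') * ‖ρ (Set.Ico s₀ (s₀ + δ))‖ₑ := by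
  have hW' : ∀ t ≤ R', ENNReal.ofReal (ω n t) ≤ W := fun t ht => by
    rw [← ENNReal.ofReal_coe_nnreal]
    exact ENNReal.ofReal_le_ofReal (hW t ht)
  have hIic : lebesgue (Set.Iic R') = R' := by
    rw [← Set.Icc_bot, lebesgue_Icc]
    simp
  have hIco : lebesgue (Set.Ico s₀ (s₀ + δ)) ≤ δ := by
    refine (measure_mono Set.Ico_subset_Icc_self).trans ?_
    rw [lebesgue_Icc]
    simp
  have h1 : ∫⁻ t in Set.Iic R', ENNReal.ofReal (ω n t) ∂lebesgue ≤ W * R' := by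
    refine (lintegral_mono_ae (ae_restrict_of_forall_mem measurableSet_Iic hW')).trans ?_
    rw [setLIntegral_const, hIic]
  have h2 : ∫⁻ t in Set.Ico s₀ (s₀ + δ), ENNReal.ofReal (ω n t) ∂lebesgue ≤ W * δ := by
    refine (lintegral_mono_ae (ae_restrict_of_forall_mem measurableSet_Ico
      fun t ht => hW' t (ht.2.le.trans (le_self_add.trans hR')))).trans ?_
    rw [setLIntegral_const]
    gcongr
  refine (lintegral_mono' (variation_cconv_restrict_le hg hgi hM hR hδ hR' ρ) le_rfl).trans ?_
  simp only [lintegral_add_measure, lintegral_smul_measure, smul_eq_mul]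
  calc _ ≤ ρ.variation (Set.Ico s₀ (s₀ + δ)) * (ε * (W * R') + M * (W * δ))
        + ‖ρ (Set.Ico s₀ (s₀ + δ))‖ₑ * M * (W * R') := by gcongr
    _ = _ := by ring

theorem restrict_Iio_mul_nat (ρ : ComplexMeasure ℝ≥0) (δ : ℝ≥0) (N : ℕ) :
    ρ.restrict (Set.Iio (N * δ)) =
      ∑ j ∈ Finset.range N, ρ.restrict (Set.Ico (j * δ) (j * δ + δ)) := by
  induction N with
  | zero => simp
  | succ N ih =>
    have hd : Disjoint (Set.Iio ((N : ℝ≥0) * δ)) (Set.Ico (N * δ) (N * δ + δ)) :=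
      Set.disjoint_left.2 fun x hx hx' => not_lt.2 hx'.1 hx
    rw [Finset.sum_range_succ, ← ih, Nat.cast_succ, add_mul, one_mul,
      ← Set.Iio_union_Ico_eq_Iio (le_self_add (a := (N : ℝ≥0) * δ) (b := δ)),
      VectorMeasure.restrict_union hd measurableSet_Iio measurableSet_Ico]

theorem enormB_cconv_sum_le (n N : ℕ) (ρ : ℕ → ComplexMeasure ℝ≥0) (κ : ComplexMeasure ℝ≥0)
    [IsFiniteMeasure κ.variation] :
    enormB ω n (cconv (∑ j ∈ Finset.range N, ρ j) κ) ≤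
      ∑ j ∈ Finset.range N, enormB ω n (cconv (ρ j) κ) := by
  induction N with
  | zero =>
    have h1 := cconv_add_left 0 0 κ
    rw [add_zero, left_eq_add] at h1
    simp [h1, enormB_zero]
  | succ N ih =>
    rw [Finset.sum_range_succ, Finset.sum_range_succ, cconv_add_left]
    exact (enormB_add_le ω n _ _).trans (add_le_add_left ih _)

/-- Convolution with a continuous density of compact support is, on measures concentrated on a
bounded interval, approximately determined by finitely many values of the measure. -/
theorem exists_enormB_cconv_Iio_le (hω : IsWeightSequence ω) (n : ℕ) {g : ℝ≥0 → ℂ}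
    (hg : Continuous g) (hgs : HasCompactSupport g) (T : ℝ≥0) {ε : ℝ≥0∞} (hε : ε ≠ 0) :
    ∃ (δ : ℝ≥0) (N : ℕ) (C : ℝ≥0), T ≤ N * δ ∧
      ∀ (ρ : ComplexMeasure ℝ≥0) [IsFiniteMeasure ρ.variation],
      enormB ω n (cconv (ρ.restrict (Set.Iio (N * δ))) (lebesgue.withDensityᵥ g)) ≤
        ε * ρ.variation Set.univ
          + C * ∑ j ∈ Finset.range N, ‖ρ (Set.Ico (j * δ) (j * δ + δ))‖ₑ := by
  have hgi : Integrable g lebesgue := hg.integrable_of_hasCompactSupport hgs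
  obtain ⟨M', hM'⟩ := hgs.exists_bound_of_continuous hg
  have hM'0 : 0 ≤ M' := (norm_nonneg _).trans (hM' 0)
  lift M' to ℝ≥0 using hM'0 with M
  have hM : ∀ t, ‖g t‖ₑ ≤ M := fun t => by
    rw [← ofReal_norm, ← ENNReal.ofReal_coe_nnreal]
    exact ENNReal.ofReal_le_ofReal (hM' t)
  obtain ⟨R, hR'⟩ := hgs.isCompact.bddAbove
  have hR : ∀ t, R < t → g t = 0 := fun t ht =>
    image_eq_zero_of_notMem_tsupport fun h => ht.not_ge (hR' h)
  -- The intervals cover `[0, N * δ)` with `N * δ ≤ T + 1`; one further unit allows for an interval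
  -- length `δ ≤ 1`, and `R` for the support of `g`.
  set R' := T + 2 + R with hR'def
  obtain ⟨W', hW'⟩ := (hω.weight n).locallyBounded R'
  have hW'0 : 0 ≤ W' := ((hω.weight n).pos 0).le.trans (hW' 0 zero_le)
  lift W' to ℝ≥0 using hW'0 with W
  obtain ⟨η, hη0, hη⟩ := ENNReal.exists_nnreal_pos_mul_lt
    (a := W * (R' + M)) (by finiteness) hε
  obtain ⟨δ₀, hδ₀, hδ⟩ := Metric.uniformContinuous_iff.1
    (hgs.uniformContinuous_of_continuous hg) η hη0
  lift δ₀ to ℝ≥0 using hδ₀.le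
  -- With `δ ≤ η`, the oscillation error and the jump error together are at most `η * (W * (R' +
  -- M))`, which is below `ε`.
  set δ := min δ₀ (min η 1) with hδdef
  have hδ0 : 0 < δ := lt_min hδ₀ (lt_min hη0 one_pos)
  have hδ1 : δ ≤ 1 := (min_le_right _ _).trans (min_le_right _ _)
  have hδη : δ ≤ η := (min_le_right _ _).trans (min_le_left _ _)
  have hδ' : ∀ a b : ℝ≥0, dist a b < δ → dist (g a) (g b) < η := fun a b hab =>
    hδ (hab.trans_le (by exact_mod_cast min_le_left _ _))
  set N := ⌈T / δ⌉₊ with hN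
  have hTN : T ≤ N * δ := by
    rw [← div_le_iff₀ hδ0]
    exact Nat.le_ceil _
  have hNT : N * δ ≤ T + 1 := by
    have h1 := (Nat.ceil_lt_add_one (zero_le (a := T / δ))).le
    calc N * δ ≤ (T / δ + 1) * δ := by gcongr
      _ = T + δ := by rw [add_mul, one_mul, div_mul_cancel₀ _ hδ0.ne']
      _ ≤ T + 1 := by gcongr
  refine ⟨δ, N, W * M * R', hTN, fun ρ _ => ?_⟩
  rw [restrict_Iio_mul_nat]
  have : IsFiniteMeasure (lebesgue.withDensityᵥ g).variation := by
    rw [Measure.variation_withDensityᵥ hgi]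
    exact isFiniteMeasure_withDensity hgi.2.ne
  refine (enormB_cconv_sum_le n N _ _).trans ?_
  have h1 : ∀ j ∈ Finset.range N, enormB ω n (cconv (ρ.restrict
      (Set.Ico (j * δ) (j * δ + δ))) (lebesgue.withDensityᵥ g)) ≤
      ε * ρ.variation (Set.Ico (j * δ) (j * δ + δ))
        + (W * M * R' : ℝ≥0) * ‖ρ (Set.Ico (j * δ) (j * δ + δ))‖ₑ := by
    intro j hj
    have hj' : (j : ℝ≥0) * δ + δ + R ≤ R' := by
      have h2 : (j : ℝ≥0) * δ ≤ N * δ := by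
        gcongr
        exact (Finset.mem_range.1 hj).le
      calc (j : ℝ≥0) * δ + δ + R ≤ (T + 1) + 1 + R := by
            gcongr
            exact h2.trans hNT
        _ = R' := by rw [hR'def]; ring
    refine (enormB_cconv_restrict_le n hg hgi hM hR hδ' hj' hW' ρ).trans ?_
    rw [ENNReal.coe_mul, ENNReal.coe_mul]
    gcongr
    refine le_trans ?_ hη.le
    calc (W : ℝ≥0∞) * (η * R' + M * δ) ≤ W * (η * R' + M * η) := by gcongr
      _ = η * (W * (R' + M)) := by ring
  refine (Finset.sum_le_sum h1).trans ?_
  rw [Finset.sum_add_distrib, ← Finset.mul_sum, ← Finset.mul_sum]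
  gcongr
  refine (sum_measure_le_measure_univ (fun j _ => measurableSet_Ico.nullMeasurableSet) ?_)
  intro i hi j hj hij
  refine (Disjoint.aedisjoint ?_)
  change Disjoint (Set.Ico ((i : ℝ≥0) * δ) (i * δ + δ)) (Set.Ico ((j : ℝ≥0) * δ) (j * δ + δ))
  wlog hlt : i < j generalizing i j
  · exact (this hj hi (Ne.symm hij) (lt_of_le_of_ne (not_lt.1 hlt) (Ne.symm hij))).symm
  · refine Set.disjoint_left.2 fun x hx hx' => (hx.2.trans_le ?_).not_ge hx'.1
    calc (i : ℝ≥0) * δ + δ = ((i + 1 : ℕ) : ℝ≥0) * δ := by push_cast; ring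
      _ ≤ j * δ := by
        gcongr
        exact hlt

/-! ### Approximating `D̄_μ` on bounded sets -/

/-- This is density of compactly supported continuous functions in `L¹` of the measure `ω_n dt`,
which is locally finite because the weight is locally bounded. -/
theorem exists_compactSupport_approx (hω : IsWeightSequence ω) (n : ℕ) {μ : ComplexMeasure ℝ≥0}
    (hμ : IsAbsCont μ) (hn : enormB ω n μ < ∞) {ε : ℝ≥0∞} (hε : ε ≠ 0) :
    ∃ g : ℝ≥0 → ℂ, Continuous g ∧ HasCompactSupport g ∧
      enormB ω n (μ - lebesgue.withDensityᵥ g) ≤ ε := by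
  have hi := μ.integrable_rnDeriv lebesgue
  have h1 := withDensity_rnDeriv_of_isAbsCont hμ
  set f := μ.rnDeriv lebesgue
  have key : ∀ u : ℝ≥0 → ℂ, ∫⁻ t, ‖u t‖ₑ ∂(lebesgue.withDensity fun t => ENNReal.ofReal (ω n t))
      = ∫⁻ t, ‖u t * (ω n t : ℂ)‖ₑ ∂lebesgue := fun u => by
    rw [lintegral_withDensity_eq_lintegral_mul_non_measurable _ (hω.measurable_ofReal n)
      (Eventually.of_forall fun t => ENNReal.ofReal_lt_top)]
    refine lintegral_congr fun t => ?_
    rw [Pi.mul_apply, enorm_mul, mul_comm, ← ofReal_norm (ω n t : ℂ), Complex.norm_real,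
      Real.norm_of_nonneg ((hω.weight n).pos t).le]
  set m := lebesgue.withDensity fun t => ENNReal.ofReal (ω n t)
  have hfm : Integrable f m := by
    refine ⟨hi.aestronglyMeasurable.mono_ac (withDensity_absolutelyContinuous _ _), ?_⟩
    rw [hasFiniteIntegral_iff_enorm, key, ← enormB_withDensity hω hi, h1]
    exact hn
  have : IsLocallyFiniteMeasure m := by
    refine ⟨fun x => ⟨Set.Iic (x + 1), Iic_mem_nhds (lt_add_one x), ?_⟩⟩
    obtain ⟨C, hC⟩ := (hω.weight n).locallyBounded (x + 1)
    rw [withDensity_apply _ measurableSet_Iic]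
    refine (lintegral_mono_ae (ae_restrict_of_forall_mem measurableSet_Iic
      fun t ht => ENNReal.ofReal_le_ofReal (hC t ht))).trans_lt ?_
    rw [setLIntegral_const, ← Set.Icc_bot, lebesgue_Icc]
    finiteness
  obtain ⟨g, hgs, hg, hgc, -⟩ := hfm.exists_hasCompactSupport_lintegral_sub_le hε
  have hgi : Integrable g lebesgue := hgc.integrable_of_hasCompactSupport hgs
  refine ⟨g, hgc, hgs, ?_⟩
  rw [← h1, ← withDensityᵥ_sub hi hgi, enormB_withDensity hω (hi.sub hgi), ← key]
  exact hg

theorem enormB_restrict {n : ℕ} {ν : ComplexMeasure ℝ≥0} {s : Set ℝ≥0} (hs : MeasurableSet s) :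
    enormB ω n (ν.restrict s) = ∫⁻ t in s, ENNReal.ofReal (ω n t) ∂ν.variation := by
  rw [enormB, VectorMeasure.variation_restrict hs]

/-- Used with the whole half-line to bound `X σ`, and with a tail and small `C` to make that tail
negligible. -/
theorem enormB_mulX_restrict_le (hω : IsWeightSequence ω) {n m : ℕ} {ν : ComplexMeasure ℝ≥0}
    {s : Set ℝ≥0} (hs : MeasurableSet s) {C : ℝ≥0} (h : ∀ t ∈ s, (t : ℝ) * ω n t ≤ C * ω m t) :
    enormB ω n ((mulX ν).restrict s) ≤ C * enormB ω m ν := by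
  rw [enormB_restrict hs, ← lintegral_indicator hs, enormB,
    ← lintegral_const_mul _ (hω.measurable_ofReal m)]
  refine (lintegral_mulX_variation_le ν ((hω.measurable_ofReal n).indicator hs)).trans
    (lintegral_mono fun t => ?_)
  by_cases ht : t ∈ s
  · rw [Set.indicator_of_mem ht, Real.enorm_of_nonneg t.coe_nonneg,
      ← ENNReal.ofReal_mul t.coe_nonneg, ← ENNReal.ofReal_coe_nnreal,
      ← ENNReal.ofReal_mul C.coe_nonneg]
    exact ENNReal.ofReal_le_ofReal (h t ht)
  · simp [Set.indicator_of_notMem ht]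

theorem exists_enormB_bound {S : Set (B ω)} (hS : Bornology.IsVonNBounded ℂ S) (n : ℕ) :
    ∃ b : ℝ≥0, ∀ σ ∈ S, enormB ω n σ.toMeasure ≤ b := by
  obtain ⟨r, hr, hb⟩ := (withSeminorms_B ω).isVonNBounded_iff_seminorm_bounded.1 hS n
  lift r to ℝ≥0 using hr.le
  refine ⟨r, fun σ hσ => ?_⟩
  rw [← ofReal_seminormB, ← ENNReal.ofReal_coe_nnreal]
  exact ENNReal.ofReal_le_ofReal (hb σ hσ).le

theorem exists_enormB_mulX_bound (hω : IsWeightSequence ω) (hc : DerivationCondition ω)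
    {S : Set (B ω)} (hS : Bornology.IsVonNBounded ℂ S) (n : ℕ) :
    ∃ P : ℝ≥0, ∀ σ ∈ S, enormB ω n (mulX σ.toMeasure) ≤ P := by
  obtain ⟨m, K, hK⟩ := hc n
  have hK0 : 0 ≤ K := (by simpa using hK ⟨0, rfl⟩)
  lift K to ℝ≥0 using hK0
  obtain ⟨b, hb⟩ := exists_enormB_bound hS m
  refine ⟨K * b, fun σ hσ => ?_⟩
  have h1 := enormB_mulX_restrict_le hω (n := n) (m := m) (ν := σ.toMeasure) (C := K)
    MeasurableSet.univ fun t _ => (div_le_iff₀ ((hω.weight m).pos t)).1 (hK ⟨t, rfl⟩)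
  rw [VectorMeasure.restrict_univ] at h1
  rw [ENNReal.coe_mul]
  exact h1.trans (by gcongr; exact hb σ hσ)

theorem exists_variation_mulX_bound (hω : IsWeightSequence ω) (hc : DerivationCondition ω)
    {S : Set (B ω)} (hS : Bornology.IsVonNBounded ℂ S) :
    ∃ Q : ℝ≥0, ∀ σ ∈ S, (mulX σ.toMeasure).variation Set.univ ≤ Q := by
  obtain ⟨P, hP⟩ := exists_enormB_mulX_bound hω hc hS 0
  obtain ⟨c, hc0, hc'⟩ := hω.exists_lower_bound 0
  lift c to ℝ≥0 using hc0.le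
  have hc1 : c ≠ 0 := (NNReal.coe_pos.1 hc0).ne'
  refine ⟨c⁻¹ * P, fun σ hσ => ?_⟩
  rw [ENNReal.coe_mul, ENNReal.coe_inv hc1, ← ENNReal.mul_le_iff_le_inv
    (by exact_mod_cast hc1) ENNReal.coe_ne_top, ← lintegral_const, ← ENNReal.ofReal_coe_nnreal]
  exact (lintegral_mono fun t => ENNReal.ofReal_le_ofReal (hc' t)).trans (hP σ hσ)

/-- On a bounded set, the values of `D̄_μ` are approximately determined by finitely many
linear functionals when `μ` is absolutely continuous. -/
theorem exists_enormB_derivB_le (hω : IsWeightSequence ω) (h : StrongDerivationCondition ω)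
    {μ : B ω} (hμ : IsAbsCont μ.toMeasure) {S : Set (B ω)} (hS : Bornology.IsVonNBounded ℂ S)
    (n : ℕ) {ε : ℝ≥0∞} (hε : ε ≠ 0) :
    ∃ (N : ℕ) (I : ℕ → Set ℝ≥0) (C : ℝ≥0), ∀ σ ∈ S,
      enormB ω n (derivB hω (h.derivationCondition hω) μ σ).toMeasure ≤
        ε + C * ∑ j ∈ Finset.range N, ‖mulX σ.toMeasure (I j)‖ₑ := by
  have hε3 : ε / 3 ≠ 0 := ENNReal.div_ne_zero.2 ⟨hε, by simp⟩
  obtain ⟨P, hX⟩ := exists_enormB_mulX_bound hω (h.derivationCondition hω) hS n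
  obtain ⟨Q, hX'⟩ := exists_variation_mulX_bound hω (h.derivationCondition hω) hS
  -- The error budget has three parts of size `ε / 3`: `η₁` for replacing `μ` by `g dt`, `η₂` for
  -- the tail of `X σ`, `η₃` for discretising the rest.
  obtain ⟨η₁, hη₁, hη₁'⟩ := ENNReal.exists_nnreal_pos_mul_lt (a := P) (by finiteness) hε3
  obtain ⟨g, hg, hgs, hgμ⟩ := exists_compactSupport_approx hω n hμ (enormB_lt_top μ n)
    (ε := η₁) (by exact_mod_cast hη₁.ne')
  have hgi : Integrable g lebesgue := hg.integrable_of_hasCompactSupport hgs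
  set G := lebesgue.withDensityᵥ g
  have hGn : enormB ω n G < ∞ := by
    have h1 := enormB_add_le ω n (G - μ.toMeasure) μ.toMeasure
    rw [sub_add_cancel] at h1
    refine h1.trans_lt (ENNReal.add_lt_top.2 ⟨?_, enormB_lt_top μ n⟩)
    rw [← neg_sub, enormB, VectorMeasure.variation_neg]
    exact hgμ.trans_lt ENNReal.coe_lt_top
  obtain ⟨m₂, hm₂⟩ := h n
  obtain ⟨b₂, hb₂⟩ := exists_enormB_bound hS m₂
  obtain ⟨η₂, hη₂, hη₂'⟩ := ENNReal.exists_nnreal_pos_mul_lt (a := b₂ * enormB ω n G)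
    (by finiteness) hε3
  -- Decay of `t ω_n(t) / ω_m(t)`, rather than mere boundedness, yields a cutoff `T` that serves all
  -- `σ ∈ S` at once.
  obtain ⟨T, hT⟩ := eventually_atTop.1 (hm₂.eventually (gt_mem_nhds (NNReal.coe_pos.2 hη₂)))
  obtain ⟨η₃, hη₃, hη₃'⟩ := ENNReal.exists_nnreal_pos_mul_lt (a := Q)
    (by finiteness) hε3
  obtain ⟨δ, N, C, hTN, hC⟩ := exists_enormB_cconv_Iio_le hω n hg hgs T (ε := η₃)
    (by exact_mod_cast hη₃.ne')
  refine ⟨N, fun j => Set.Ico (j * δ) (j * δ + δ), C, fun σ hσ => ?_⟩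
  rw [derivB_toMeasure]
  set ρ := mulX σ.toMeasure
  set U := Set.Iio ((N : ℝ≥0) * δ)
  have hfin : ∀ {κ : ComplexMeasure ℝ≥0}, enormB ω n κ < ∞ → IsFiniteMeasure κ.variation :=
    fun hκ => hω.isFiniteMeasure hκ
  have hρ : IsFiniteMeasure ρ.variation := hfin ((hX σ hσ).trans_lt (by finiteness))
  have hGf := hfin hGn
  have hdiff := hfin (hgμ.trans_lt ENNReal.coe_lt_top)
  have hr : ∀ {s : Set ℝ≥0}, MeasurableSet s → IsFiniteMeasure (ρ.restrict s).variation :=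
    fun hs => by rw [VectorMeasure.variation_restrict hs]; infer_instance
  have hr1 := hr (measurableSet_Iio (a := (N : ℝ≥0) * δ))
  have hr2 := hr (measurableSet_Iio (a := (N : ℝ≥0) * δ)).compl
  have hdec : cconv ρ μ.toMeasure = cconv ρ (μ.toMeasure - G) +
      (cconv (ρ.restrict U) G + cconv (ρ.restrict Uᶜ) G) := by
    rw [← cconv_add_left, VectorMeasure.restrict_add_restrict_compl measurableSet_Iio,
      ← cconv_add_right, sub_add_cancel]
  have htail : enormB ω n (ρ.restrict Uᶜ) ≤ η₂ * b₂ := by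
    refine (enormB_mulX_restrict_le hω (m := m₂) measurableSet_Iio.compl fun t ht => ?_).trans
      (mul_le_mul_right (hb₂ σ hσ) _)
    have h1 : T ≤ t := hTN.trans (not_lt.1 ht)
    exact (div_le_iff₀ ((hω.weight m₂).pos t)).1 (hT t h1).le
  rw [hdec]
  refine (enormB_add_le ω n _ _).trans ((add_le_add_right (enormB_add_le ω n _ _) _).trans ?_)
  have e1 : enormB ω n (cconv ρ (μ.toMeasure - G)) ≤ ε / 3 := by
    refine (enormB_cconv_le hω n _ _).trans (le_trans ?_ hη₁'.le)
    rw [mul_comm]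
    exact mul_le_mul' hgμ (hX σ hσ)
  have e2 : enormB ω n (cconv (ρ.restrict Uᶜ) G) ≤ ε / 3 := by
    refine (enormB_cconv_le hω n _ _).trans (le_trans ?_ hη₂'.le)
    rw [← mul_assoc]
    gcongr
  have e3 := (hC ρ).trans (add_le_add_left ((mul_le_mul_right (hX' σ hσ) _).trans hη₃'.le) _)
  calc _ ≤ ε / 3 + ((ε / 3 + C * ∑ j ∈ Finset.range N, ‖ρ (Set.Ico (j * δ) (j * δ + δ))‖ₑ)
        + ε / 3) := by gcongr
    _ = (ε / 3 + ε / 3 + ε / 3) + C * ∑ j ∈ Finset.range N, ‖ρ (Set.Ico (j * δ) (j * δ + δ))‖ₑ := by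
        ring
    _ = _ := by rw [ENNReal.add_thirds]

/-! ### Relative compactness in `A(ω)` -/

/-- The map `f ↦ f ω_n` from `A(ω)` to `L¹`. -/
def A.toL1 (n : ℕ) : A ω →ₗ[ℂ] Lp ℂ 1 lebesgue where
  toFun f := (f.integrable_mul n).toL1 _
  map_add' f g := by
    rw [← Integrable.toL1_add, Integrable.toL1_eq_toL1_iff]
    filter_upwards [AEEqFun.coeFn_add f.toFun g.toFun] with t ht
    rw [map_add, ht, Pi.add_apply, Pi.add_apply, add_mul]
  map_smul' c f := by
    rw [RingHom.id_apply, ← Integrable.toL1_smul, Integrable.toL1_eq_toL1_iff]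
    filter_upwards [AEEqFun.coeFn_smul c f.toFun] with t ht
    rw [map_smul, ht, Pi.smul_apply, smul_eq_mul, smul_eq_mul, mul_assoc]

theorem A.norm_toL1 (n : ℕ) (f : A ω) : ‖A.toL1 n f‖ = seminormA ω n f :=
  L1.norm_of_fun_eq_integral_norm (f.integrable_mul n)

theorem topology_eq_induced_of_norm_eq {E F : Type*} [AddCommGroup E] [Module ℂ E]
    [NormedAddCommGroup F] [NormedSpace ℂ F] {p : Seminorm ℂ E} (e : E →ₗ[ℂ] F)
    (he : ∀ x, ‖e x‖ = p x) :
    p.toSeminormedAddCommGroup.toUniformSpace.toTopologicalSpace = .induced e inferInstance := by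
  let _ := p.toSeminormedAddCommGroup
  exact (AddMonoidHomClass.isometry_of_norm e he).isUniformInducing.isInducing.eq_induced

theorem A.isInducing_toL1 :
    IsInducing fun (f : A ω) (n : ℕ) => A.toL1 n f := by
  refine ⟨?_⟩
  rw [(SeminormFamily.withSeminorms_iff_topologicalSpace_eq_iInf _).1 (withSeminorms_A ω),
    Pi.topologicalSpace, induced_iInf]
  refine iInf_congr fun n => ?_
  rw [induced_compose]
  exact topology_eq_induced_of_norm_eq (A.toL1 n) (A.norm_toL1 n)

theorem IsWeightSequence.integrable_div (hω : IsWeightSequence ω) (n : ℕ) (F : Lp ℂ 1 lebesgue) :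
    Integrable (fun t => F t * ((ω n t)⁻¹ : ℝ)) lebesgue := by
  obtain ⟨c, hc, hc'⟩ := hω.exists_lower_bound n
  refine (L1.integrable_coeFn F).mul_bdd (c := c⁻¹)
    (Complex.measurable_ofReal.comp (hω.weight n).measurable.inv).aestronglyMeasurable
    (Eventually.of_forall fun t => ?_)
  rw [Complex.norm_real, Real.norm_of_nonneg (inv_nonneg.2 ((hω.weight n).pos t).le)]
  exact inv_anti₀ hc (hc' t)

/-- The map `F ↦ F / ω_n` on `L¹`. -/
def divWeight (hω : IsWeightSequence ω) (n : ℕ) (F : Lp ℂ 1 lebesgue) : Lp ℂ 1 lebesgue :=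
  (hω.integrable_div n F).toL1 _

theorem continuous_divWeight (hω : IsWeightSequence ω) (n : ℕ) :
    Continuous (divWeight hω n) := by
  obtain ⟨c, hc, hc'⟩ := hω.exists_lower_bound n
  lift c to ℝ≥0 using hc.le
  refine (LipschitzWith.of_dist_le_mul (K := c⁻¹) fun F G => ?_).continuous
  rw [dist_eq_norm, dist_eq_norm, divWeight, divWeight, ← Integrable.toL1_sub,
    L1.norm_of_fun_eq_integral_norm, L1.norm_eq_integral_norm, NNReal.coe_inv,
    ← integral_const_mul]
  refine integral_mono_ae ((hω.integrable_div n F).sub (hω.integrable_div n G)).norm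
    ((L1.integrable_coeFn (F - G)).norm.const_mul _) ?_
  filter_upwards [Lp.coeFn_sub F G] with t ht
  rw [ht, Pi.sub_apply, Pi.sub_apply, ← sub_mul, norm_mul, mul_comm, Complex.norm_real,
    Real.norm_of_nonneg (inv_nonneg.2 ((hω.weight n).pos t).le)]
  gcongr
  exact hc' t

/-- A sequence in `L¹` comes from `A(ω)` exactly when dividing out the weights gives one common
function. Division by a weight is continuous on `L¹`, so this condition is closed. -/
theorem A.range_toL1 (hω : IsWeightSequence ω) :
    Set.range (fun (f : A ω) (n : ℕ) => A.toL1 n f) =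
      {F | ∀ n, divWeight hω n (F n) = divWeight hω 0 (F 0)} := by
  have hcancel : ∀ n t, (ω n t : ℂ) * ((ω n t)⁻¹ : ℝ) = 1 := fun n t => by
    rw [← Complex.ofReal_mul, mul_inv_cancel₀ ((hω.weight n).pos t).ne', Complex.ofReal_one]
  apply Set.Subset.antisymm
  · rintro _ ⟨f, rfl⟩
    have h1 : ∀ n, (fun t => A.toL1 n f t * ((ω n t)⁻¹ : ℝ)) =ᵐ[lebesgue] f.toFun := fun n => by
      filter_upwards [(f.integrable_mul n).coeFn_toL1] with t ht
      change (f.integrable_mul n).toL1 _ t * _ = _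
      rw [ht, mul_assoc, hcancel, mul_one]
    intro n
    rw [divWeight, divWeight, Integrable.toL1_eq_toL1_iff]
    exact (h1 n).trans (h1 0).symm
  · intro F hF
    set u := divWeight hω 0 (F 0)
    have h1 : ∀ n, (fun t => u t * (ω n t : ℂ)) =ᵐ[lebesgue] F n := fun n => by
      have hu : divWeight hω n (F n) = u := hF n
      rw [← hu]
      filter_upwards [(hω.integrable_div n (F n)).coeFn_toL1] with t ht
      change (hω.integrable_div n (F n)).toL1 _ t * _ = _
      rw [ht, mul_assoc, mul_comm (((ω n t)⁻¹ : ℝ) : ℂ), hcancel, mul_one]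
    let f : A ω := ⟨u.1, fun n => (L1.integrable_coeFn (F n)).congr (h1 n).symm⟩
    exact ⟨f, funext fun n => Lp.ext ((f.integrable_mul n).coeFn_toL1.trans (h1 n))⟩

theorem A.isClosed_range_toL1 (hω : IsWeightSequence ω) :
    IsClosed (Set.range fun (f : A ω) (n : ℕ) => A.toL1 n f) := by
  rw [A.range_toL1 hω, Set.ofPred_forall]
  exact isClosed_iInter fun n => isClosed_eq ((continuous_divWeight hω n).comp (continuous_apply n))
    ((continuous_divWeight hω 0).comp (continuous_apply 0))

/-- `A(ω)` is embedded as a closed subset of a countable product of copies of `L¹`, so by Tychonoff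
compactness can be tested one norm at a time. -/
theorem A.isCompact_closure (hω : IsWeightSequence ω) {K : Set (A ω)}
    (hK : ∀ n, TotallyBounded (A.toL1 n '' K)) : IsCompact (closure K) := by
  have h1 : IsCompact (Set.univ.pi fun n => closure (A.toL1 n '' K)) :=
    isCompact_univ_pi fun n => (hK n).closure.isCompact_of_isClosed isClosed_closure
  have h2 := A.isInducing_toL1.isCompact_preimage (A.isClosed_range_toL1 hω) h1
  have h3 : IsClosed ((fun (f : A ω) (n : ℕ) => A.toL1 n f) ⁻¹'
      (Set.univ.pi fun n => closure (A.toL1 n '' K))) :=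
    (isClosed_set_pi fun n _ => isClosed_closure).preimage A.isInducing_toL1.continuous
  refine h2.of_isClosed_subset isClosed_closure (closure_minimal (fun f hf => ?_) h3)
  exact fun n _ => subset_closure (Set.mem_image_of_mem _ hf)

/-! ### The Montel property and the equivalence -/

theorem mulX_sub (hω : IsWeightSequence ω) (hc : DerivationCondition ω) (σ τ : B ω) :
    mulX (σ - τ).toMeasure = mulX σ.toMeasure - mulX τ.toMeasure := by
  rw [eq_sub_iff_add_eq, ← mulX_add (integrable_coe hω hc _) (integrable_coe hω hc _), ← map_add,
    sub_add_cancel]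

/-- If `μ` is absolutely continuous then `D̄_μ`, regarded as an operator from `B(ω)` to `A(ω)`, is
Montel. -/
theorem isMontel_of_isAbsCont (hω : IsWeightSequence ω) (h : StrongDerivationCondition ω)
    {μ : B ω} (hμ : IsAbsCont μ.toMeasure) {T : B ω →ₗ[ℂ] A ω}
    (hT : ∀ σ, incl hω (T σ) = derivB hω (h.derivationCondition hω) μ σ) : IsMontel T := by
  intro S hS
  have hc := h.derivationCondition hω
  refine A.isCompact_closure hω fun n => ?_
  refine Metric.totallyBounded_of_finite_discretization fun ε hε => ?_
  -- The estimate is applied to `S - S`, which is again bounded, since total boundedness compares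
  -- two images and the operator is linear.
  obtain ⟨N, I, C, hC⟩ := exists_enormB_derivB_le hω h hμ (hS.sub hS) n
    (ε := ENNReal.ofReal (ε / 2)) (by simpa using hε)
  obtain ⟨Q, hQ⟩ := exists_variation_mulX_bound hω hc hS
  set V : B ω → Fin N → ℂ := fun σ j => mulX σ.toMeasure (I j) with hV
  have hVb : TotallyBounded (V '' S) := by
    refine (isCompact_closedBall (0 : Fin N → ℂ) Q).totallyBounded.subset ?_
    rintro _ ⟨σ, hσ, rfl⟩
    rw [mem_closedBall_zero_iff, pi_norm_le_iff_of_nonneg Q.coe_nonneg]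
    intro j
    have h1 := (VectorMeasure.enorm_measure_le_variation (mulX σ.toMeasure) (I j)).trans
      ((measure_mono (Set.subset_univ _)).trans (hQ σ hσ))
    rw [← ofReal_norm, ← ENNReal.ofReal_coe_nnreal,
      ENNReal.ofReal_le_ofReal_iff Q.coe_nonneg] at h1
    exact h1
  -- Two elements assigned to the same centre have coordinates within `2 * η`; summed over `N`
  -- pieces and multiplied by `C`, this must stay below `ε / 2`.
  obtain ⟨η, hη0, hη⟩ : ∃ η : ℝ, 0 < η ∧ C * (N * (2 * η)) < ε / 2 := by
    refine ⟨ε / 2 / (2 * (C * N + 1)), by positivity, ?_⟩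
    have h1 : (0 : ℝ) < C * N + 1 := by positivity
    rw [show (C : ℝ) * (N * (2 * (ε / 2 / (2 * (C * N + 1))))) =
      (ε / 2) * ((C * N) / (C * N + 1)) by field_simp]
    exact mul_lt_of_lt_one_right (by positivity) ((div_lt_one h1).2 (lt_add_one _))
  obtain ⟨t, ht, htV⟩ := Metric.totallyBounded_iff.1 hVb η hη0
  have hx : ∀ x : A.toL1 n '' (T '' S), ∃ σ ∈ S, A.toL1 n (T σ) = x ∧ ∃ c : t, dist (V σ) c < η := by
    rintro ⟨_, _, ⟨σ, hσ, rfl⟩, rfl⟩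
    obtain ⟨c, hct, hc⟩ := Set.mem_iUnion₂.1 (htV ⟨σ, hσ, rfl⟩)
    exact ⟨σ, hσ, rfl, ⟨c, hct⟩, hc⟩
  choose σ hσ hσx F hF using hx
  refine ⟨t, ht.fintype, F, fun x y hxy => ?_⟩
  have hd : dist (V (σ x)) (V (σ y)) ≤ 2 * η := by
    have h1 := hF y
    rw [← hxy] at h1
    linarith [dist_triangle_right (V (σ x)) (V (σ y)) (F x), hF x]
  have h1 := hC (σ x - σ y) (Set.sub_mem_sub (hσ x) (hσ y))
  have h2 : ∑ j ∈ Finset.range N, ‖mulX (σ x - σ y).toMeasure (I j)‖ₑ ≤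
      ENNReal.ofReal (N * (2 * η)) := by
    rw [Finset.sum_range]
    have h3 : ∀ j : Fin N, ‖mulX (σ x - σ y).toMeasure (I j)‖ₑ ≤ ENNReal.ofReal (2 * η) := by
      intro j
      rw [mulX_sub hω hc, ← ofReal_norm]
      refine ENNReal.ofReal_le_ofReal (le_trans ?_ hd)
      exact (dist_eq_norm (V (σ x) j) (V (σ y) j)).symm.le.trans (dist_le_pi_dist _ _ j)
    refine (Finset.sum_le_sum fun j _ => h3 j).trans_eq ?_
    simp [ENNReal.ofReal_mul]
  rw [← hσx x, ← hσx y, dist_eq_norm, ← map_sub, ← map_sub, A.norm_toL1, ← seminormB_incl hω, hT]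
  have h3 : ENNReal.ofReal (seminormB ω n (derivB hω hc μ (σ x - σ y))) ≤
      ENNReal.ofReal (ε / 2 + C * (N * (2 * η))) := by
    rw [ofReal_seminormB, ENNReal.ofReal_add (by positivity) (by positivity),
      ENNReal.ofReal_mul C.coe_nonneg, ENNReal.ofReal_coe_nnreal]
    exact h1.trans (by gcongr)
  rw [ENNReal.ofReal_le_ofReal_iff (by positivity)] at h3
  linarith

section

variable {E F G : Type*} [AddCommGroup E] [Module ℂ E] [TopologicalSpace E]
  [AddCommGroup F] [Module ℂ F] [TopologicalSpace F]
  [AddCommGroup G] [Module ℂ G] [TopologicalSpace G]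

theorem IsMontel.isWeaklyMontel {T : E →ₗ[ℂ] F} (hT : IsMontel T) : IsWeaklyMontel T := by
  intro S hS
  exact ((hT S hS).image (toWeakSpaceCLM ℂ F).continuous).closure_of_subset
    (Set.image_mono subset_closure)

theorem IsMontel.comp_continuous {T : F →ₗ[ℂ] G} (hT : IsMontel T) (L : E →L[ℂ] F) :
    IsMontel (T ∘ₗ L.toLinearMap) := by
  intro S hS
  have h1 := hT _ (hS.image L)
  rwa [← Set.image_comp] at h1

theorem IsMontel.continuous_comp [R1Space G] {T : E →ₗ[ℂ] F} (hT : IsMontel T) (L : F →L[ℂ] G) :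
    IsMontel (L.toLinearMap ∘ₗ T) := by
  intro S hS
  refine ((hT S hS).image L.continuous).closure_of_subset ?_
  rintro _ ⟨x, hx, rfl⟩
  exact ⟨T x, subset_closure ⟨x, hx, rfl⟩, rfl⟩

end

/-- Convolution with an absolutely continuous `μ` is absolutely continuous, so `D̄_μ` takes its
values in the copy of `A(ω)`. Compactness can then be proved once, in `A(ω)`, for both operators. -/
theorem exists_factor_of_isAbsCont (hω : IsWeightSequence ω) (hc : DerivationCondition ω)
    {μ : B ω} (hμ : IsAbsCont μ.toMeasure) :
    ∃ T : B ω →ₗ[ℂ] A ω, ∀ σ, incl hω (T σ) = derivB hω hc μ σ := by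
  have hmem : ∀ σ, derivB hω hc μ σ ∈ LinearMap.range (incl hω) := fun σ => by
    have := hω.isFiniteMeasure (enormB_mulX_lt_top hω hc σ 0)
    exact mem_range_incl hω (isAbsCont_cconv_right hμ)
  refine ⟨(LinearEquiv.ofInjective (incl hω) (incl_injective hω)).symm.toLinearMap ∘ₗ
    (derivB hω hc μ).codRestrict (LinearMap.range (incl hω)) hmem, fun σ => ?_⟩
  exact congrArg Subtype.val ((LinearEquiv.ofInjective (incl hω)
    (incl_injective hω)).apply_symm_apply ⟨_, hmem σ⟩)

theorem isAbsCont_of_isWeaklyMontel_derivB (hω : IsWeightSequence ω) (hc : DerivationCondition ω)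
    (μ : B ω) (h : IsWeaklyMontel (derivB hω hc μ)) : IsAbsCont μ.toMeasure := by
  refine isAbsCont_of_weaklyCompact hω hc μ fun f hf =>
    ⟨_, h _ (isVonNBounded_incl_image hω hf), fun k => subset_closure ?_⟩
  exact Set.mem_image_of_mem _ (Set.mem_image_of_mem _ (Set.mem_image_of_mem _ ⟨k, rfl⟩))

/-- The inclusion is weakly continuous, so it carries weakly compact sets of `A(ω)` to weakly
compact sets of `B(ω)`. -/
theorem isAbsCont_of_isWeaklyMontel_derivA (hω : IsWeightSequence ω) (hc : DerivationCondition ω)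
    (μ : B ω) (h : IsWeaklyMontel (derivA hω hc μ)) : IsAbsCont μ.toMeasure := by
  refine isAbsCont_of_weaklyCompact hω hc μ fun f hf =>
    ⟨_, (h _ hf).image (WeakSpace.map (inclCLM hω)).continuous, fun k =>
      ⟨toWeakSpace ℂ (A ω) (derivA hω hc μ (f k)), subset_closure ?_, ?_⟩⟩
  · exact Set.mem_image_of_mem _ (Set.mem_image_of_mem _ ⟨k, rfl⟩)
  · exact incl_derivA hω hc μ (f k)

end WeightedConv

end

open WeightedConv
theorem mainTheorem3 (ω : ℕ → ℝ≥0 → ℝ) (hω : IsWeightSequence ω)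
    (h : StrongDerivationCondition ω) (μ : B ω) :
    List.TFAE [
      IsMontel (derivA hω (h.derivationCondition hω) μ),
      IsWeaklyMontel (derivA hω (h.derivationCondition hω) μ),
      IsAbsCont μ.toMeasure,
      IsMontel (derivB hω (h.derivationCondition hω) μ),
      IsWeaklyMontel (derivB hω (h.derivationCondition hω) μ)] := by
  have hc := h.derivationCondition hω
  tfae_have 1 → 2 := IsMontel.isWeaklyMontel
  tfae_have 4 → 5 := IsMontel.isWeaklyMontel
  tfae_have 2 → 3 := isAbsCont_of_isWeaklyMontel_derivA hω hc μ
  tfae_have 5 → 3 := isAbsCont_of_isWeaklyMontel_derivB hω hc μ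
  tfae_have 3 → 1 := fun hμ => by
    obtain ⟨T, hT⟩ := exists_factor_of_isAbsCont hω hc hμ
    have h1 : derivA hω hc μ = T ∘ₗ (inclCLM hω).toLinearMap := LinearMap.ext fun f =>
      incl_injective hω ((incl_derivA hω hc μ f).trans (hT (incl hω f)).symm)
    rw [h1]
    exact (isMontel_of_isAbsCont hω h hμ hT).comp_continuous _
  tfae_have 3 → 4 := fun hμ => by
    obtain ⟨T, hT⟩ := exists_factor_of_isAbsCont hω hc hμ
    have h1 : derivB hω hc μ = (inclCLM hω).toLinearMap ∘ₗ T :=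
      LinearMap.ext fun σ => (hT σ).symm
    rw [h1]
    exact (isMontel_of_isAbsCont hω h hμ hT).continuous_comp _
  tfae_finish
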